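/- Let $\beta>1$ be a real transcendental number and let $\mathbb T^2=\mathbb R^2/\mathbb Z^2$ be the flat torus. Define $F_A:\mathbb T^2\to\mathbb T^2$ by $F_A(x,y)=([\beta x+y],[2y])$ for $(x,y)\in[0,1)^2$, where $[t]=t-\lfloor t\rfloor$. Put $\Gamma=\{0\}\times\mathbb T^1$, let $M=[0,1]\times\mathbb T^1$ be the torus cut open along $\Gamma$, extend $F_A$ continuously from $\mathbb T^2\setminus\Gamma=(0,1)\times\mathbb T^1$ to $M$, and let $\gamma_r=\{1\}\times\mathbb T^1\subset\partial M$. Derivatives at points of $\Gamma$ are those of the branch defined on $[0,1)^2$, and at points of $\partial M$ those of the extension. For a weight $\varphi$ write $\varphi_n=\prod_{k=0}^{n-1}\varphi\circ F_A^k$, and let $$\Lambda_{BV}(F_A,\varphi,\gamma_r)=\liminf_{k\to\infty}\Bigl(\inf_{x\in\gamma_r}\bigl|\varphi_k(x)\,J_{\gamma_r}F_A^k(x)\bigr|\Bigr)^{1/k},$$ where $J_{\gamma_r}F_A^k(x)=\|D_xF_A^k\tau\|$, with $\tau$ a unit tangent vector of $\gamma_r$ at $x$, is the Jacobian of $F_A^k$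 along $\gamma_r$ (at points of $M$ the first iterate of $F_A$ and the first factor of $\varphi_k$ are the extensions to $M$). Let $\Omega$ be a finite family of pairwise disjoint open polygons in $\mathbb T^2$ (open sets whose boundary lies in a finite union of segments), of full total measure, disjoint from $\Gamma$, on each of which $F_A$ is injective. Let $\Omega^n$ be the set of non-empty cylinders $\bigcap_{k<n}F_A^{-k}\omega_k$, $\omega_k\in\Omega$, and let $$h_m(F_A)=\lim_{n\to\infty}\frac1n\log\max_{x\in M}\#\{\omega\in\Omega^n : x\in\overline\omega\},\qquad \overline\Lambda(F_A,\varphi)=e^{h_m(F_A)}\lim_{n\to\infty}\bigl\|\varphi_n\,\det DF_A^n\,\lambda_n^{-1}\bigr\|_{L^\infty}^{1/n},$$ where closures in the first formula are taken in $M$, and $\lambda_n(z)=\inf\{\|D_zF^n_{A,\omega}v\| : \omega\in\Omega^n,\ z\in\overline\omega,\ \|v\|=1\}$, with $F^n_{A,\omega}$ the extension of $F_A^n|_\omega$ to $\overline\omega$. Then such families $\Omega$ exist, and for every such $\Omega$ the limits defining $h_m(F_A)$, $\overline\Lambda(F_A,1)$ and $\overline\Lambda(F_A,|\det DF_A|^{-1})$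 exist, $h_m(F_A)=0$, and $$\overline\Lambda(F_A,1)=\Lambda_{BV}(F_A,1,\gamma_r)=\max\{2,\beta\},$$ $$\overline\Lambda(F_A,|\det DF_A|^{-1})=\Lambda_{BV}(F_A,|\det DF_A|^{-1},\gamma_r)=\min\{2,\beta\}^{-1}.$$ -/

import Mathlib

open Filter Topology MeasureTheory
open scoped ENNReal

noncomputable section

namespace CutTorus

/-- The flat torus `𝕋² = ℝ²/ℤ²`; its `volume` is Lebesgue measure. -/
abbrev Torus : Type := UnitAddCircle × UnitAddCircle

/-- The Euclidean plane, which is every tangent space of the flat torus. -/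
abbrev Plane : Type := EuclideanSpace ℝ (Fin 2)

/-- The covering projection `ℝ² → 𝕋²`. -/
def proj (v : Plane) : Torus := ((v 0 : UnitAddCircle), (v 1 : UnitAddCircle))

/-- The curve `Γ = {0} × 𝕋¹`. -/
def cutCurve : Set Torus := {z | z.1 = 0}

/-- The torus cut open along `Γ`: the manifold with boundary `M = [0,1] × 𝕋¹`. -/
abbrev Cut : Type := Set.Icc (0 : ℝ) 1 × UnitAddCircle

/-- The gluing map `ι : M → 𝕋²`. -/
def glue (x : Cut) : Torus := (((x.1 : ℝ) : UnitAddCircle), x.2)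

/-- The interior `(0,1) × 𝕋¹` of `M`, which `ι` identifies with `𝕋² \ Γ`. -/
def cutInterior : Set Cut := {x | 0 < (x.1 : ℝ) ∧ (x.1 : ℝ) < 1}

/-- The right boundary curve `γ_r = {1} × 𝕋¹` of `M`. -/
def rightCurve : Set Cut := {x | (x.1 : ℝ) = 1}

/-- The representative in `[0,1)` of a point of the circle. -/
def rep (a : UnitAddCircle) : ℝ := (AddCircle.equivIco (1 : ℝ) 0 a : ℝ)

theorem rep_mem (a : UnitAddCircle) : rep a ∈ Set.Ico (0 : ℝ) 1 := by
  have h := (AddCircle.equivIco (1 : ℝ) 0 a).2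
  simpa [rep] using h

/-- The section `𝕋² → M` of `ι` with values in `[0,1) × 𝕋¹`. -/
def toCut (z : Torus) : Cut :=
  (⟨rep z.1, (rep_mem z.1).1, (rep_mem z.1).2.le⟩, z.2)

/-- The continuous extension to `M` of a map defined on `𝕋² \ Γ`. -/
def extend {Y : Type} [TopologicalSpace Y] [Nonempty Y] (G : Torus → Y) : Cut → Y :=
  extendFrom cutInterior (fun x => G (glue x))

/-- `L` is the derivative at `p`, within `s`, of the torus-valued map `g` (or, when `p` is only in
the closure of `s`, of its extension to `p`): locally on `s`, the map `g` lifts to a map into the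
plane which has derivative `L` at `p`. -/
def HasTorusFDerivWithinAt (g : Plane → Torus) (L : Plane →L[ℝ] Plane) (s : Set Plane)
    (p : Plane) : Prop :=
  ∃ f : Plane → Plane, HasFDerivWithinAt f L s p ∧ ∀ᶠ q in 𝓝[s] p, g q = proj (f q)

open Classical in
/-- The derivative in the sense of `HasTorusFDerivWithinAt` (zero if there is none). -/
def torusFDerivWithin (g : Plane → Torus) (s : Set Plane) (p : Plane) : Plane →L[ℝ] Plane :=
  if h : ∃ L, HasTorusFDerivWithinAt g L s p then h.choose else 0

/-- `D_z G_ω`: the derivative at `z` of (the extension to `closure ω` of) the restriction of `G`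
to `ω`. -/
def derivOn (G : Torus → Torus) (ω : Set Torus) (z : Torus) : Plane →L[ℝ] Plane :=
  torusFDerivWithin (fun v => G (z + proj v)) {v | z + proj v ∈ ω} 0

/-- The derivative at `x ∈ M` of the extension of `F` to `M`; it is one-sided on `∂M`. -/
def derivCut (F : Torus → Torus) (x : Cut) : Plane →L[ℝ] Plane :=
  torusFDerivWithin (fun v => F (glue x + proj v)) {v | 0 < (x.1 : ℝ) + v 0 ∧ (x.1 : ℝ) + v 0 < 1} 0

/-- The derivative `DF^k` at a point of `M`, along the orbit
`x, F x, F (F x), …`, where on the first step `F` is the extension to `M`. -/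
def derivIter (F : Torus → Torus) : ℕ → Cut → (Plane →L[ℝ] Plane)
  | 0, _ => ContinuousLinearMap.id ℝ Plane
  | k + 1, x => (derivIter F k (toCut (extend F x))).comp (derivCut F x)

/-- `φ_n = ∏_{k<n} φ ∘ F^k` on the torus. -/
def weightProd (F : Torus → Torus) (φ : Torus → ℂ) (n : ℕ) (z : Torus) : ℂ :=
  ∏ k ∈ Finset.range n, φ (F^[k] z)

/-- `φ_n` at a point of `M`, where on the first step `φ` and `F` are the extensions to `M`. -/
def weightProdCut (F : Torus → Torus) (φ : Torus → ℂ) : ℕ → Cut → ℂ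
  | 0, _ => 1
  | n + 1, x => extend φ x * weightProd F φ n (extend F x)

/-- The unit tangent vectors at `x` of a curve `γ ⊂ M`. -/
def unitTangents (γ : Set Cut) (x : Cut) : Set Plane :=
  {τ | ‖τ‖ = 1 ∧ τ ∈ tangentConeAt ℝ
    {v : Plane | ∃ y ∈ γ, (y.1 : ℝ) = (x.1 : ℝ) + v 0 ∧ y.2 = x.2 + (v 1 : UnitAddCircle)} 0}

/-- `Λ_BV(F, φ, γ) = liminf_k (inf_{x ∈ γ} |φ_k(x) · J_γ F^k(x)|)^{1/k}`, the Jacobian along the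
curve being `J_γ F^k(x) = ‖D_x F^k τ‖` for a unit tangent vector `τ` of `γ` at `x`. -/
def LambdaBV (F : Torus → Torus) (φ : Torus → ℂ) (γ : Set Cut) : ℝ≥0∞ :=
  liminf (fun k : ℕ =>
    (⨅ x ∈ γ, ⨅ τ ∈ unitTangents γ x,
      ‖weightProdCut F φ k x‖ₑ * ‖derivIter F k x τ‖ₑ) ^ (1 / (k : ℝ))) atTop

/-- The weight `|det DF|⁻¹`. On `Γ` the derivative is that from the fundamental domain `[0,1)²`. -/
def invDetWeight (F : Torus → Torus) (z : Torus) : ℂ :=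
  ((|(derivCut F (toCut z)).det|⁻¹ : ℝ) : ℂ)

/-- A finite partition, modulo a null set, of the torus into open polygons (sets whose frontier
consists of finitely many segments) that avoid `Γ` and on which `F` is injective. -/
structure IsPolygonalPartition (F : Torus → Torus) (Ω : Set (Set Torus)) : Prop where
  finite : Ω.Finite
  isOpen : ∀ ω ∈ Ω, IsOpen ω
  disjoint : Ω.PairwiseDisjoint id
  full : volume (⋃₀ Ω)ᶜ = 0
  avoids : ∀ ω ∈ Ω, Disjoint ω cutCurve
  injOn : ∀ ω ∈ Ω, Set.InjOn F ω
  polygonal : ∀ ω ∈ Ω, ∃ S : Set (Plane × Plane), S.Finite ∧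
    frontier ω ⊆ ⋃ p ∈ S, proj '' segment ℝ p.1 p.2

/-- The partition `Ω^n` into the nonempty cylinders `⋂_{k<n} F^{-k} ω_k`, `ω_k ∈ Ω`. -/
def cylinders (F : Torus → Torus) (Ω : Set (Set Torus)) (n : ℕ) : Set (Set Torus) :=
  {C | C.Nonempty ∧ ∃ w : Fin n → Set Torus,
    (∀ k, w k ∈ Ω) ∧ C = ⋂ k : Fin n, F^[k] ⁻¹' w k}

/-- `max_{x ∈ M} #{ω ∈ Ω^n : x ∈ closure ω}`, with closures taken in `M`. -/
def multiplicity (F : Torus → Torus) (Ω : Set (Set Torus)) (n : ℕ) : ℕ :=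
  ⨆ x : Cut, Set.ncard {C | C ∈ cylinders F Ω n ∧ x ∈ closure (glue ⁻¹' C)}

/-- The multiplicity entropy `h_m(F) = lim (1/n) log max_x #{ω ∈ Ω^n : x ∈ closure ω}` exists and
equals `h`. -/
def HasMultiplicityEntropy (F : Torus → Torus) (Ω : Set (Set Torus)) (h : ℝ) : Prop :=
  Tendsto (fun n : ℕ => 1 / (n : ℝ) * Real.log (multiplicity F Ω n)) atTop (𝓝 h)

/-- The minimal expansion `λ_n(z) = inf_ω inf_{‖v‖ = 1} ‖D_z F^n_ω v‖`, over the `ω ∈ Ω^n` with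
`z ∈ closure ω`. -/
def minExpansion (F : Torus → Torus) (Ω : Set (Set Torus)) (n : ℕ) (z : Torus) : ℝ≥0∞ :=
  ⨅ C ∈ cylinders F Ω n, ⨅ (_ : z ∈ closure C), ⨅ (v : Plane) (_ : ‖v‖ = 1),
    ‖derivOn F^[n] C z v‖ₑ

/-- The quantity `e^{h_m(F)} · lim_n ‖φ_n · det DF^n · λ_n⁻¹‖_{L^∞}^{1/n}` exists (that is, both
limits exist) and equals `Λ`. -/
def HasLambdaBar (F : Torus → Torus) (φ : Torus → ℂ) (Ω : Set (Set Torus)) (Λ : ℝ≥0∞) : Prop :=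
  ∃ (h : ℝ) (l : ℝ≥0∞), HasMultiplicityEntropy F Ω h ∧
    Tendsto (fun n : ℕ =>
      (essSup (fun z : Torus => ‖weightProd F φ n z‖ₑ *
        ‖(derivOn F^[n] Set.univ z).det‖ₑ * (minExpansion F Ω n z)⁻¹) volume) ^ (1 / (n : ℝ)))
      atTop (𝓝 l) ∧
    Λ = ENNReal.ofReal (Real.exp h) * l

/-- `F_A(x,y) = ([βx + y], [2y])` for `(x,y) ∈ [0,1)²`, where `[·]` is the fractional part. -/
def affineMap (β : ℝ) (z : Torus) : Torus :=
  ((Int.fract (β * rep z.1 + rep z.2) : ℝ), (Int.fract (2 * rep z.2) : ℝ))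

end CutTorus

end

namespace CutTorus

/-! ### The covering projection -/

/-! Away from Γ the map is locally affine with one linear part A, with rows (β, 1) and (0, 2), so
every derivative of an n-th iterate is Aⁿ, the determinant is (2β)ⁿ, and both weights are constants
c. Since β is transcendental, β ≠ 2, so A is diagonalizable and its powers grow like pure
exponentials up to constants, which n-th roots remove (`tendsto_root_of_bounds`).

The tangent to γ_r is vertical, and a vertical vector has a component along both eigendirections;
hence ‖Aᵏτ‖ is of order max(2, β)ᵏ and Λ_BV is |c| max(2, β) (`LambdaBV_affineMap_const`). On the
other side the smallest stretching by Aⁿ is of order min(2, β)ⁿ, and (2β)ⁿ / min(2, β)ⁿ = max(2,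
β)ⁿ. This gives the same value once h_m = 0 is known (`hasLambdaBar_affineMap_const`). The essential
supremum is taken of an almost everywhere constant function: F_A is nonsingular, so almost every
point lies in a cylinder, and such a point lies in the closure of no other one
(`minExpansion_eq_of_mem`).

For h_m = 0 (`hasMultiplicityEntropy_zero`), look at the germs of the n-cylinders at a point. Their
boundaries lie on lines through that point, namely the pullbacks by Aᵏ, k < n, of finitely many
directions: those of the polygon sides, and the vertical one, along which F_A is discontinuous. On a
sector between these lines the iterates are affine and the itinerary is constant. As m·n lines bound
O(n) sectors, the multiplicity grows at most linearly (`ncard_cylinders_le`, `ncard_le_of_signs`).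
-/

@[simp] theorem proj_fst (v : Plane) : (proj v).1 = (v 0 : UnitAddCircle) := rfl

@[simp] theorem proj_snd (v : Plane) : (proj v).2 = (v 1 : UnitAddCircle) := rfl

@[simp] theorem proj_zero : proj 0 = 0 := rfl

theorem proj_add (v w : Plane) : proj (v + w) = proj v + proj w := rfl

theorem proj_sub (v w : Plane) : proj (v - w) = proj v - proj w := rfl

theorem continuous_proj : Continuous proj := by
  unfold proj
  exact ((AddCircle.continuous_mk' 1).comp (by fun_prop)).prodMk
    ((AddCircle.continuous_mk' 1).comp (by fun_prop))

theorem proj_surjective : Function.Surjective proj := by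
  rintro ⟨a, b⟩
  obtain ⟨s, rfl⟩ := QuotientAddGroup.mk_surjective a
  obtain ⟨t, rfl⟩ := QuotientAddGroup.mk_surjective b
  exact ⟨!₂[s, t], rfl⟩

theorem eq_zero_of_coe_eq_zero {x : ℝ} (h : (x : UnitAddCircle) = 0) (hx : |x| < 1) : x = 0 := by
  obtain ⟨n, rfl⟩ := (AddCircle.coe_eq_zero_iff (1 : ℝ)).1 h
  have h1 : |n| < 1 := by
    have h2 : |(n : ℝ)| < 1 := by simpa using hx
    exact_mod_cast h2
  simp [Int.abs_lt_one_iff.1 h1]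

theorem eq_zero_of_proj_eq_zero {v : Plane} (h : proj v = 0) (hv : ‖v‖ < 1) : v = 0 := by
  have hi : ∀ i, |v i| < 1 := fun i =>
    (by simpa using PiLp.norm_apply_le v i : |v i| ≤ ‖v‖).trans_lt hv
  ext i
  fin_cases i
  · exact eq_zero_of_coe_eq_zero (congrArg Prod.fst h) (hi 0)
  · exact eq_zero_of_coe_eq_zero (congrArg Prod.snd h) (hi 1)

theorem rep_coe (a : UnitAddCircle) : ((rep a : ℝ) : UnitAddCircle) = a :=
  AddCircle.coe_equivIco

theorem rep_coe_of_mem {x : ℝ} (hx : x ∈ Set.Ico (0 : ℝ) 1) : rep (x : UnitAddCircle) = x := by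
  have h := AddCircle.coe_equivIco_mk_apply (1 : ℝ) x
  rw [rep]
  refine h.trans ?_
  rw [div_one, mul_one, Int.fract_eq_self.2 hx]

theorem measurable_rep : Measurable rep :=
  measurable_subtype_coe.comp (AddCircle.measurableEquivIco 1 0).measurable

/-! ### Derivatives of torus-valued maps -/

/-- Two lifts differ by a vector of ℤ² on `s` near `p`, up to continuity at `p`; lattice points
being isolated, the difference is locally constant and has derivative zero. -/
theorem HasTorusFDerivWithinAt.unique {g : Plane → Torus} {L L' : Plane →L[ℝ] Plane}
    {s : Set Plane} {p : Plane} (hs : UniqueDiffWithinAt ℝ s p)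
    (h : HasTorusFDerivWithinAt g L s p) (h' : HasTorusFDerivWithinAt g L' s p) : L = L' := by
  obtain ⟨f, hf, hfg⟩ := h
  obtain ⟨f', hf', hfg'⟩ := h'
  have hp : p ∈ closure s := hs.mem_closure
  have : NeBot (𝓝[s] p) := mem_closure_iff_nhdsWithin_neBot.1 hp
  have hd := hf.sub hf'
  have hc : Tendsto (fun q => (f - f') q) (𝓝[s] p) (𝓝 ((f - f') p)) := hd.continuousWithinAt
  set u := (f - f') p with hu
  have hz : ∀ᶠ q in 𝓝[s] p, proj ((f - f') q) = 0 := by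
    filter_upwards [hfg, hfg'] with q h1 h2
    rw [Pi.sub_apply, proj_sub, ← h1, ← h2, sub_self]
  have hu0 : proj u = 0 := by
    have h1 : Tendsto (fun q => proj ((f - f') q)) (𝓝[s] p) (𝓝 (proj u)) :=
      (continuous_proj.tendsto _).comp hc
    exact tendsto_nhds_unique h1 (tendsto_const_nhds.congr' (hz.mono fun q hq => hq.symm))
  have hnear : ∀ᶠ q in 𝓝[s] p, ‖(f - f') q - u‖ < 1 := by
    have := hc.eventually (Metric.ball_mem_nhds u one_pos)
    filter_upwards [this] with q hq
    exact mem_ball_iff_norm.1 hq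
  have heq : ∀ᶠ q in 𝓝[s] p, (f - f') q = u := by
    filter_upwards [hz, hnear] with q h1 h2
    refine sub_eq_zero.1 (eq_zero_of_proj_eq_zero ?_ h2)
    rw [proj_sub, h1, hu0, sub_zero]
  have h0 : HasFDerivWithinAt (f - f') (0 : Plane →L[ℝ] Plane) s p :=
    (hasFDerivWithinAt_const u p s).congr_of_eventuallyEq heq rfl
  exact sub_eq_zero.1 (hs.eq hd h0)

theorem HasTorusFDerivWithinAt.torusFDerivWithin {g : Plane → Torus} {L : Plane →L[ℝ] Plane}
    {s : Set Plane} {p : Plane} (hs : UniqueDiffWithinAt ℝ s p)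
    (h : HasTorusFDerivWithinAt g L s p) : torusFDerivWithin g s p = L := by
  have hex : ∃ L, HasTorusFDerivWithinAt g L s p := ⟨L, h⟩
  rw [CutTorus.torusFDerivWithin, dif_pos hex]
  exact hex.choose_spec.unique hs h

theorem hasTorusFDerivWithinAt_of_affine {g : Plane → Torus} {L : Plane →L[ℝ] Plane}
    {s : Set Plane} {p : Plane} {y : Torus} (h : ∀ᶠ q in 𝓝[s] p, g q = y + proj (L q)) :
    HasTorusFDerivWithinAt g L s p := by
  obtain ⟨c, rfl⟩ := proj_surjective y
  exact ⟨fun q => c + L q, L.hasFDerivWithinAt.const_add c, h⟩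

/-! ### The linear part -/

/-- The linear part of `F_A`. -/
noncomputable def linPart (β : ℝ) : Plane →L[ℝ] Plane :=
  Matrix.toEuclideanCLM (n := Fin 2) (𝕜 := ℝ) !![β, 1; 0, 2]

@[simp] theorem linPart_apply_zero (β : ℝ) (v : Plane) : linPart β v 0 = β * v 0 + v 1 := by
  simp [linPart, Matrix.mulVec, dotProduct, Fin.sum_univ_two]

@[simp] theorem linPart_apply_one (β : ℝ) (v : Plane) : linPart β v 1 = 2 * v 1 := by
  simp [linPart, Matrix.mulVec, dotProduct, Fin.sum_univ_two]

theorem det_linPart (β : ℝ) : (linPart β).det = 2 * β := by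
  have h : ((linPart β : Plane →L[ℝ] Plane) : Plane →ₗ[ℝ] Plane)
      = Matrix.toLin (EuclideanSpace.basisFun (Fin 2) ℝ).toBasis
        (EuclideanSpace.basisFun (Fin 2) ℝ).toBasis !![β, 1; 0, 2] := by
    rw [linPart, Matrix.coe_toEuclideanCLM_eq_toEuclideanLin,
      Matrix.toEuclideanLin_eq_toLin_orthonormal]
  rw [ContinuousLinearMap.det, h, LinearMap.det_toLin]
  simp [Matrix.det_fin_two, mul_comm]

theorem det_linPart_pow (β : ℝ) (n : ℕ) : (linPart β ^ n).det = (2 * β) ^ n := by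
  rw [← det_linPart, ContinuousLinearMap.det, ContinuousLinearMap.det]
  rw [← map_pow, ContinuousLinearMap.toLinearMap_pow]

theorem linPart_injective {β : ℝ} (hβ : β ≠ 0) : Function.Injective (linPart β) := by
  refine (injective_iff_map_eq_zero _).2 fun v hv => ?_
  have h0 : β * v 0 + v 1 = 0 := by rw [← linPart_apply_zero, hv]; rfl
  have h1 : 2 * v 1 = 0 := by rw [← linPart_apply_one β, hv]; rfl
  have h1' : v 1 = 0 := by linarith
  have h0' : v 0 = 0 := by simpa [h1', hβ] using h0
  ext i
  fin_cases i
  · exact h0'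
  · exact h1'

theorem linPart_pow_injective {β : ℝ} (hβ : β ≠ 0) (n : ℕ) :
    Function.Injective (linPart β ^ n : Plane →L[ℝ] Plane) := by
  induction n with
  | zero => exact Function.injective_id
  | succ n ih =>
    rw [pow_succ]
    exact ih.comp (linPart_injective hβ)

/-! ### Local form of the map -/

theorem affineMap_eq (β : ℝ) (z : Torus) :
    affineMap β z = (((β * rep z.1 : ℝ) : UnitAddCircle) + z.2, z.2 + z.2) := by
  rw [affineMap, AddCircle.coe_fract, AddCircle.coe_fract, AddCircle.coe_add, rep_coe, two_mul,
    AddCircle.coe_add, rep_coe]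

/-- The lift `c` need not be the representative in [0,1): `c = 1` gives the continuation to the
right boundary, with `v 0 < 0`. -/
theorem affineMap_add_proj {β c : ℝ} {z : Torus} (hc : z.1 = (c : UnitAddCircle)) {v : Plane}
    (hv : c + v 0 ∈ Set.Ico (0 : ℝ) 1) :
    affineMap β (z + proj v)
      = (((β * c : ℝ) : UnitAddCircle) + z.2, z.2 + z.2) + proj (linPart β v) := by
  rw [affineMap_eq]
  have h : (z + proj v).1 = ((c + v 0 : ℝ) : UnitAddCircle) := by
    rw [AddCircle.coe_add, ← hc]; rfl
  rw [h, rep_coe_of_mem hv]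
  ext
  · simp only [Prod.snd_add, Prod.fst_add, proj_snd, proj_fst, linPart_apply_zero, mul_add,
      AddCircle.coe_add]
    abel
  · simp only [Prod.snd_add, proj_snd, linPart_apply_one, two_mul, AddCircle.coe_add]
    abel

theorem derivCut_affineMap (β : ℝ) (x : Cut) : derivCut (affineMap β) x = linPart β := by
  obtain ⟨hx0, hx1⟩ := x.1.2
  refine HasTorusFDerivWithinAt.torusFDerivWithin ?_ (hasTorusFDerivWithinAt_of_affine
    (y := (((β * (x.1 : ℝ) : ℝ) : UnitAddCircle) + (glue x).2, (glue x).2 + (glue x).2)) ?_)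
  · have hset : {v : Plane | 0 < (x.1 : ℝ) + v 0 ∧ (x.1 : ℝ) + v 0 < 1}
        = (EuclideanSpace.proj (0 : Fin 2) : Plane →L[ℝ] ℝ) ⁻¹'
          Set.Ioo (-(x.1 : ℝ)) (1 - (x.1 : ℝ)) := by
      ext v
      change _ ↔ -(x.1 : ℝ) < v 0 ∧ v 0 < 1 - (x.1 : ℝ)
      change (0 < (x.1 : ℝ) + v 0 ∧ (x.1 : ℝ) + v 0 < 1) ↔ _
      constructor <;> rintro ⟨h1, h2⟩ <;> constructor <;> linarith
    have hcont : Continuous (EuclideanSpace.proj (0 : Fin 2) : Plane →L[ℝ] ℝ) :=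
      ContinuousLinearMap.continuous _
    have hopen : IsOpenMap (EuclideanSpace.proj (0 : Fin 2) : Plane →L[ℝ] ℝ) :=
      ContinuousLinearMap.isOpenMap _ fun t => ⟨!₂[t, 0], rfl⟩
    rw [hset]
    -- The domain is a vertical strip, convex with interior, and the base point lies in its closure
    -- even when `x ∈ ∂M`.
    refine uniqueDiffWithinAt_convex ((convex_Ioo _ _).linear_preimage
      ((EuclideanSpace.proj (0 : Fin 2) : Plane →L[ℝ] ℝ) : Plane →ₗ[ℝ] ℝ)) ?_ ?_
    · refine ⟨!₂[1 / 2 - (x.1 : ℝ), 0], interior_maximal subset_rfl (isOpen_Ioo.preimage hcont) ?_⟩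
      change -(x.1 : ℝ) < 1 / 2 - (x.1 : ℝ) ∧ 1 / 2 - (x.1 : ℝ) < 1 - (x.1 : ℝ)
      constructor <;> linarith
    · change (0 : Plane) ∈ closure ((EuclideanSpace.proj (0 : Fin 2) : Plane →L[ℝ] ℝ) ⁻¹' _)
      rw [← hopen.preimage_closure_eq_closure_preimage hcont, closure_Ioo (by linarith)]
      exact ⟨by simpa using hx0, by simpa using hx1⟩
  · filter_upwards [self_mem_nhdsWithin] with v hv
    exact affineMap_add_proj rfl ⟨hv.1.le, hv.2⟩

theorem derivIter_affineMap (β : ℝ) (k : ℕ) (x : Cut) :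
    derivIter (affineMap β) k x = linPart β ^ k := by
  induction k generalizing x with
  | zero => rfl
  | succ k ih =>
    rw [derivIter, ih, derivCut_affineMap, pow_succ]
    rfl

theorem invDetWeight_affineMap (β : ℝ) :
    invDetWeight (affineMap β) = fun _ => ((|2 * β|⁻¹ : ℝ) : ℂ) := by
  funext z
  rw [invDetWeight, derivCut_affineMap, det_linPart]

theorem weightProd_const (F : Torus → Torus) (c : ℂ) (n : ℕ) (z : Torus) :
    weightProd F (fun _ => c) n z = c ^ n := by
  simp [weightProd]

theorem mem_closure_cutInterior (x : Cut) : x ∈ closure cutInterior := by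
  have h : cutInterior = (Subtype.val ⁻¹' Set.Ioo (0 : ℝ) 1 : Set (Set.Icc (0 : ℝ) 1)) ×ˢ
      (Set.univ : Set UnitAddCircle) := by
    ext y; simp [cutInterior]
  rw [h, closure_prod_eq, closure_univ]
  refine ⟨?_, trivial⟩
  rw [closure_subtype, Subtype.image_preimage_coe,
    Set.inter_eq_right.2 Set.Ioo_subset_Icc_self, closure_Ioo zero_ne_one]
  exact x.1.2

theorem extend_const {Y : Type} [TopologicalSpace Y] [T2Space Y] [Nonempty Y] (c : Y) (x : Cut) :
    extend (fun _ => c) x = c :=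
  extendFrom_eq (mem_closure_cutInterior x) tendsto_const_nhds

theorem weightProdCut_const (F : Torus → Torus) (c : ℂ) (n : ℕ) (x : Cut) :
    weightProdCut F (fun _ => c) n x = c ^ n := by
  cases n with
  | zero => rfl
  | succ n => rw [weightProdCut, extend_const, weightProd_const, pow_succ']

/-! ### Growth of the powers of the linear part -/

theorem linPart_pow_apply_one (β : ℝ) (n : ℕ) (v : Plane) :
    (linPart β ^ n) v 1 = 2 ^ n * v 1 := by
  induction n with
  | zero => simp
  | succ n ih =>
    rw [pow_succ', mul_apply_eq_comp, linPart_apply_one, ih]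
    ring

/-- Diagonalization: (1, 0) and (1, 2 - β) are eigenvectors for β and 2, and `v` has coordinates `v
0 + v 1 / (β - 2)` and `-(v 1 / (β - 2))` in this basis. For β = 2 a Jordan block would appear
instead. -/
theorem linPart_pow_apply_zero {β : ℝ} (h2 : β ≠ 2) (n : ℕ) (v : Plane) :
    (linPart β ^ n) v 0 = β ^ n * (v 0 + v 1 / (β - 2)) - 2 ^ n * (v 1 / (β - 2)) := by
  have hq : β - 2 ≠ 0 := sub_ne_zero.2 h2
  induction n with
  | zero => simp
  | succ n ih =>
    rw [pow_succ', mul_apply_eq_comp, linPart_apply_zero, ih, linPart_pow_apply_one]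
    field_simp
    ring

theorem abs_apply_le_norm (v : Plane) (i : Fin 2) : |v i| ≤ ‖v‖ := by
  simpa using PiLp.norm_apply_le v i

theorem norm_le_abs_add_abs (v : Plane) : ‖v‖ ≤ |v 0| + |v 1| := by
  rw [EuclideanSpace.norm_eq, Fin.sum_univ_two]
  refine Real.sqrt_le_iff.2 ⟨by positivity, ?_⟩
  simp only [Real.norm_eq_abs]
  nlinarith [abs_nonneg (v 0), abs_nonneg (v 1)]

theorem exists_le_norm_linPart_pow {β : ℝ} (hβ : 1 < β) (h2 : β ≠ 2) :
    ∃ c : ℝ, 0 < c ∧ ∀ (n : ℕ) (v : Plane), c * min 2 β ^ n * ‖v‖ ≤ ‖(linPart β ^ n) v‖ := by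
  have hq : 0 < |β - 2| := abs_pos.2 (sub_ne_zero.2 h2)
  set κ := |β - 2|⁻¹ with hκ
  have hκ0 : 0 < κ := inv_pos.2 hq
  -- The two factors are the costs of the change of basis: `1 + κ` bounds `v` by `|a| + |v 1|`, and
  -- `2 + κ` bounds the same coordinates of the image by `‖w‖`.
  refine ⟨((1 + κ) * (2 + κ))⁻¹, by positivity, fun n v => ?_⟩
  set w := (linPart β ^ n) v with hw
  set a := v 0 + v 1 / (β - 2) with ha
  have hm : 0 < min 2 β := lt_min two_pos (by linarith)
  have hm2 : min 2 β ^ n ≤ 2 ^ n := pow_le_pow_left₀ hm.le (min_le_left _ _) n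
  have hmβ : min 2 β ^ n ≤ β ^ n := pow_le_pow_left₀ hm.le (min_le_right _ _) n
  have hv1 : |v 1 / (β - 2)| = κ * |v 1| := by rw [abs_div, hκ]; ring
  have hb : 2 ^ n * |v 1| ≤ ‖w‖ := by
    have := abs_apply_le_norm w 1
    rwa [hw, linPart_pow_apply_one, abs_mul, abs_of_pos (by positivity)] at this
  have hA : β ^ n * |a| ≤ (1 + κ) * ‖w‖ := by
    have h0 := abs_apply_le_norm w 0
    have h1 : β ^ n * a = w 0 + 2 ^ n * (v 1 / (β - 2)) := by
      rw [hw, linPart_pow_apply_zero h2]; ring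
    calc β ^ n * |a| = |β ^ n * a| := by
          rw [abs_mul, abs_of_pos (by positivity : 0 < β ^ n)]
      _ ≤ |w 0| + |2 ^ n * (v 1 / (β - 2))| := by rw [h1]; exact abs_add_le _ _
      _ = |w 0| + κ * (2 ^ n * |v 1|) := by
        rw [abs_mul, abs_of_pos (by positivity : (0 : ℝ) < 2 ^ n), hv1]; ring
      _ ≤ ‖w‖ + κ * ‖w‖ := by gcongr
      _ = _ := by ring
  have hsum : min 2 β ^ n * (|a| + |v 1|) ≤ (2 + κ) * ‖w‖ := by
    have h1 := mul_le_mul_of_nonneg_right hm2 (abs_nonneg (v 1))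
    have h2 := mul_le_mul_of_nonneg_right hmβ (abs_nonneg a)
    linarith
  have hv : ‖v‖ ≤ (1 + κ) * (|a| + |v 1|) := by
    have h0 : |v 0| ≤ |a| + κ * |v 1| := by
      have : v 0 = a - v 1 / (β - 2) := by rw [ha]; ring
      rw [this, ← hv1]
      exact abs_sub _ _
    have := norm_le_abs_add_abs v
    nlinarith [mul_nonneg hκ0.le (abs_nonneg a)]
  rw [mul_assoc, inv_mul_le_iff₀ (by positivity)]
  calc min 2 β ^ n * ‖v‖ ≤ min 2 β ^ n * ((1 + κ) * (|a| + |v 1|)) := by gcongr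
    _ = (1 + κ) * (min 2 β ^ n * (|a| + |v 1|)) := by ring
    _ ≤ (1 + κ) * ((2 + κ) * ‖w‖) := by gcongr
    _ = _ := by ring

/-- An eigenvector of the smaller eigenvalue shows that the rate in `exists_le_norm_linPart_pow` is
sharp. -/
theorem exists_unit_linPart_pow_eq_smul {β : ℝ} (h2 : β ≠ 2) :
    ∃ v : Plane, ‖v‖ = 1 ∧ ∀ n : ℕ, (linPart β ^ n) v = min 2 β ^ n • v := by
  suffices h : ∃ v : Plane, v ≠ 0 ∧ ∀ n : ℕ, (linPart β ^ n) v = min 2 β ^ n • v by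
    obtain ⟨v, hv, h⟩ := h
    refine ⟨‖v‖⁻¹ • v, norm_smul_inv_norm hv, fun n => ?_⟩
    rw [map_smul, h, smul_comm]
  have hq : β - 2 ≠ 0 := sub_ne_zero.2 h2
  rcases le_total β 2 with h | h
  · refine ⟨!₂[1, 0], fun h0 => by simpa using congrArg (fun v : Plane => v 0) h0, fun n => ?_⟩
    ext i
    fin_cases i
    · simpa [min_eq_right h] using linPart_pow_apply_zero h2 n !₂[1, 0]
    · simpa using linPart_pow_apply_one β n !₂[1, 0]
  · refine ⟨!₂[1, -(β - 2)], fun h0 => by simpa using congrArg (fun v : Plane => v 0) h0,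
      fun n => ?_⟩
    ext i
    fin_cases i
    · have := linPart_pow_apply_zero h2 n !₂[1, -(β - 2)]
      simp only [Fin.zero_eta, this, min_eq_left h]
      simp
      field_simp
      ring
    · simpa [min_eq_left h] using linPart_pow_apply_one β n !₂[1, -(β - 2)]

/-- The vertical unit vector. -/
noncomputable def vert : Plane := !₂[0, 1]

theorem norm_vert : ‖vert‖ = 1 := by
  simp [vert, EuclideanSpace.norm_eq]

theorem max_pow_le_norm_linPart_pow_vert {β : ℝ} (h2 : β ≠ 2) (n : ℕ) :
    (|β - 2| + 1)⁻¹ * max 2 β ^ n ≤ ‖(linPart β ^ n) vert‖ := by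
  set w := (linPart β ^ n) vert with hw
  have hq : β - 2 ≠ 0 := sub_ne_zero.2 h2
  have h1 : w 1 = 2 ^ n := by rw [hw, linPart_pow_apply_one]; simp [vert]
  -- The row vector (β - 2, 1) is a left eigenvector of A for β and takes the value 1 on `vert`.
  have h0 : β ^ n = (β - 2) * w 0 + w 1 := by
    rw [h1, hw, linPart_pow_apply_zero h2]
    simp [vert]
    field_simp
    ring
  have hw0 := abs_apply_le_norm w 0
  have hw1 := abs_apply_le_norm w 1
  rw [inv_mul_le_iff₀ (by positivity)]
  rcases le_total β 2 with h | h
  · rw [max_eq_left h, ← h1]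
    have := mul_nonneg (abs_nonneg (β - 2)) (norm_nonneg w)
    linarith [le_abs_self (w 1)]
  · rw [max_eq_right h, h0]
    calc (β - 2) * w 0 + w 1 ≤ |(β - 2) * w 0| + |w 1| :=
          add_le_add (le_abs_self _) (le_abs_self _)
      _ ≤ |β - 2| * ‖w‖ + ‖w‖ := by rw [abs_mul]; gcongr
      _ = _ := by ring

theorem norm_linPart_pow_vert_le {β : ℝ} (hβ : 1 < β) (h2 : β ≠ 2) (n : ℕ) :
    ‖(linPart β ^ n) vert‖ ≤ (2 * |β - 2|⁻¹ + 1) * max 2 β ^ n := by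
  set w := (linPart β ^ n) vert with hw
  have h1 : w 1 = 2 ^ n := by rw [hw, linPart_pow_apply_one]; simp [vert]
  have h0 : w 0 = β ^ n * (β - 2)⁻¹ - 2 ^ n * (β - 2)⁻¹ := by
    rw [hw, linPart_pow_apply_zero h2]
    simp [vert]
  have hm2 : (2 : ℝ) ^ n ≤ max 2 β ^ n := pow_le_pow_left₀ (by positivity) (le_max_left _ _) n
  have hmβ : β ^ n ≤ max 2 β ^ n := pow_le_pow_left₀ (by linarith) (le_max_right _ _) n
  calc ‖w‖ ≤ |w 0| + |w 1| := norm_le_abs_add_abs w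
    _ ≤ (|β ^ n * (β - 2)⁻¹| + |2 ^ n * (β - 2)⁻¹|) + 2 ^ n := by
      rw [h0, h1, abs_of_pos (by positivity : (0 : ℝ) < 2 ^ n)]
      gcongr
      exact abs_sub _ _
    _ = β ^ n * |β - 2|⁻¹ + 2 ^ n * |β - 2|⁻¹ + 2 ^ n := by
      rw [abs_mul, abs_mul, abs_inv, abs_of_pos (by positivity : (0 : ℝ) < 2 ^ n),
        abs_of_pos (by positivity : 0 < β ^ n)]
    _ ≤ max 2 β ^ n * |β - 2|⁻¹ + max 2 β ^ n * |β - 2|⁻¹ + max 2 β ^ n := by gcongr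
    _ = _ := by ring

/-! ### Roots of exponentially growing sequences -/

theorem tendsto_ofReal_mul_pow_root {c r : ℝ} (hc : 0 < c) (hr : 0 < r) :
    Tendsto (fun n : ℕ => ENNReal.ofReal (c * r ^ n) ^ (1 / (n : ℝ))) atTop
      (𝓝 (ENNReal.ofReal r)) := by
  have h1 : Tendsto (fun n : ℕ => ENNReal.ofReal (c ^ (1 / (n : ℝ)) * r)) atTop
      (𝓝 (ENNReal.ofReal (c ^ (0 : ℝ) * r))) := by
    refine (ENNReal.continuous_ofReal.tendsto _).comp (Tendsto.mul_const r ?_)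
    exact ((Real.continuous_const_rpow hc.ne').tendsto 0).comp tendsto_one_div_atTop_nhds_zero_nat
  rw [Real.rpow_zero, one_mul] at h1
  refine h1.congr' ?_
  filter_upwards [eventually_ge_atTop 1] with n hn
  have hn0 : (n : ℝ) ≠ 0 := by positivity
  rw [ENNReal.ofReal_rpow_of_pos (by positivity), Real.mul_rpow hc.le (by positivity),
    ← Real.rpow_natCast r n, ← Real.rpow_mul hr.le, mul_one_div_cancel hn0, Real.rpow_one]

theorem tendsto_root_of_bounds {u : ℕ → ℝ≥0∞} {c C r : ℝ} (hc : 0 < c) (hC : 0 < C) (hr : 0 < r)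
    (hl : ∀ n, ENNReal.ofReal (c * r ^ n) ≤ u n) (hu : ∀ n, u n ≤ ENNReal.ofReal (C * r ^ n)) :
    Tendsto (fun n : ℕ => u n ^ (1 / (n : ℝ))) atTop (𝓝 (ENNReal.ofReal r)) :=
  tendsto_of_tendsto_of_tendsto_of_le_of_le (tendsto_ofReal_mul_pow_root hc hr)
    (tendsto_ofReal_mul_pow_root hC hr)
    (fun n => ENNReal.rpow_le_rpow (hl n) (by positivity))
    (fun n => ENNReal.rpow_le_rpow (hu n) (by positivity))

/-! ### The boundary curve -/

/-- All displacements within γ_r have first coordinate zero, and this survives scaling and limits.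
-/
theorem eq_smul_vert_of_mem_unitTangents {x : Cut} (hx : x ∈ rightCurve) {τ : Plane}
    (hτ : τ ∈ unitTangents rightCurve x) : τ = τ 1 • vert := by
  obtain ⟨α, l, hl, c, d, -, hd, hcd⟩ := exists_fun_of_mem_tangentConeAt hτ.2
  have h0 : Tendsto (fun n => (c n • d n) 0) l (𝓝 (τ 0)) :=
    ((by fun_prop : Continuous fun v : Plane => v 0).tendsto τ).comp hcd
  have h1 : ∀ᶠ n in l, (c n • d n) 0 = 0 := by
    filter_upwards [hd] with n hn
    obtain ⟨y, hy, h, -⟩ := hn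
    have hx1 : (x.1 : ℝ) = 1 := hx
    have hy1 : (y.1 : ℝ) = 1 := hy
    have : d n 0 = 0 := by
      rw [hx1, hy1, zero_add] at h
      linarith
    simp [this]
  have h2 : τ 0 = 0 :=
    tendsto_nhds_unique h0 (tendsto_const_nhds.congr' (h1.mono fun n hn => hn.symm))
  ext i
  fin_cases i
  · simpa [vert] using h2
  · simp [vert]

theorem vert_mem_unitTangents {x : Cut} (hx : x ∈ rightCurve) :
    vert ∈ unitTangents rightCurve x := by
  refine ⟨norm_vert, ?_⟩
  have h : segment ℝ 0 vert ⊆ {v : Plane | ∃ y ∈ rightCurve, (y.1 : ℝ) = (x.1 : ℝ) + v 0 ∧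
      y.2 = x.2 + (v 1 : UnitAddCircle)} := by
    rintro v ⟨a, b, -, -, -, rfl⟩
    exact ⟨(x.1, x.2 + ((a • (0 : Plane) + b • vert : Plane) 1 : UnitAddCircle)), hx,
      by simp [vert], rfl⟩
  simpa using mem_tangentConeAt_of_segment_subset h

/-- Both index sets are nonempty, so the infimum of a constant does not degenerate to `⊤`. -/
theorem iInf_rightCurve_eq {f : Cut → Plane → ℝ≥0∞} {K : ℝ≥0∞}
    (hf : ∀ x ∈ rightCurve, ∀ τ ∈ unitTangents rightCurve x, f x τ = K) :
    ⨅ x ∈ rightCurve, ⨅ τ ∈ unitTangents rightCurve x, f x τ = K := by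
  refine le_antisymm ?_ (le_iInf₂ fun x hx => le_iInf₂ fun τ hτ => (hf x hx τ hτ).ge)
  have hx : ((⟨1, by norm_num⟩, 0) : Cut) ∈ rightCurve := rfl
  exact (iInf₂_le _ hx).trans ((iInf₂_le _ (vert_mem_unitTangents hx)).trans
    (hf _ hx _ (vert_mem_unitTangents hx)).le)

theorem LambdaBV_affineMap_const {β : ℝ} (hβ : 1 < β) (h2 : β ≠ 2) {c : ℂ} (hc : c ≠ 0) :
    LambdaBV (affineMap β) (fun _ => c) rightCurve = ENNReal.ofReal (‖c‖ * max 2 β) := by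
  have hc' : 0 < ‖c‖ := norm_pos_iff.2 hc
  have hK : ∀ k : ℕ, (⨅ x ∈ rightCurve, ⨅ τ ∈ unitTangents rightCurve x,
      ‖weightProdCut (affineMap β) (fun _ => c) k x‖ₑ * ‖derivIter (affineMap β) k x τ‖ₑ)
        = ENNReal.ofReal (‖c‖ ^ k * ‖(linPart β ^ k) vert‖) := by
    intro k
    refine iInf_rightCurve_eq fun x hx τ hτ => ?_
    have h := eq_smul_vert_of_mem_unitTangents hx hτ
    have h1 : ‖τ 1‖ = 1 := by
      have := hτ.1
      rwa [h, norm_smul, norm_vert, mul_one] at this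
    rw [weightProdCut_const, derivIter_affineMap, h, map_smul, ← ofReal_norm, ← ofReal_norm,
      ← ENNReal.ofReal_mul (norm_nonneg _), norm_smul, h1, one_mul, norm_pow]
  unfold LambdaBV
  simp only [hK]
  refine Tendsto.liminf_eq (tendsto_root_of_bounds (c := (|β - 2| + 1)⁻¹)
    (C := 2 * |β - 2|⁻¹ + 1) (by positivity) (by positivity) (by positivity) ?_ ?_)
  · intro n
    refine ENNReal.ofReal_le_ofReal ?_
    rw [mul_pow, mul_left_comm]
    gcongr
    exact max_pow_le_norm_linPart_pow_vert h2 n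
  · intro n
    refine ENNReal.ofReal_le_ofReal ?_
    rw [mul_pow, mul_left_comm]
    gcongr
    exact norm_linPart_pow_vert_le hβ h2 n

/-! ### Nonsingularity -/

theorem quasiMeasurePreserving_rep :
    Measure.QuasiMeasurePreserving rep (volume : Measure UnitAddCircle) volume := by
  refine ⟨measurable_rep, Measure.AbsolutelyContinuous.mk fun N hN h0 => ?_⟩
  rw [Measure.map_apply measurable_rep hN]
  have hmk := UnitAddCircle.measurePreserving_mk 0
  rw [← hmk.measure_preimage (measurable_rep hN).nullMeasurableSet,
    Measure.restrict_apply (hmk.measurable (measurable_rep hN))]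
  -- The quotient map is measure preserving from (0,1] while `rep` takes values in [0,1); the two
  -- domains differ by a null set.
  refine measure_mono_null (t := N ∪ {1}) ?_ (measure_union_null h0 Real.volume_singleton)
  rintro x ⟨hx, hx0, hx1⟩
  rcases eq_or_ne x 1 with rfl | h1
  · exact Or.inr rfl
  · left
    have hx1' : x < 1 := lt_of_le_of_ne (by linarith) h1
    have : rep (x : UnitAddCircle) ∈ N := hx
    rwa [rep_coe_of_mem ⟨hx0.le, hx1'⟩] at this

theorem quasiMeasurePreserving_coe :
    Measure.QuasiMeasurePreserving (fun x : ℝ => (x : UnitAddCircle)) volume volume := by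
  have hm : Measurable (fun x : ℝ => (x : UnitAddCircle)) :=
    (UnitAddCircle.measurePreserving_mk 0).measurable
  refine ⟨hm, Measure.AbsolutelyContinuous.mk fun N hN h0 => ?_⟩
  rw [Measure.map_apply hm hN]
  refine measure_mono_null (t := ⋃ n : ℤ, (fun x : ℝ => (x : UnitAddCircle)) ⁻¹' N ∩
    Set.Ioc (n : ℝ) (n + 1)) ?_ (measure_iUnion_null fun n => ?_)
  · intro x hx
    refine Set.mem_iUnion.2 ⟨⌈x⌉ - 1, hx, ?_, ?_⟩
    · have := Int.ceil_lt_add_one x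
      push_cast
      linarith
    · push_cast
      linarith [Int.le_ceil x]
  · have hmk := UnitAddCircle.measurePreserving_mk (n : ℝ)
    have h := hmk.measure_preimage hN.nullMeasurableSet
    rw [Measure.restrict_apply (hmk.measurable hN), h0] at h
    exact h

theorem quasiMeasurePreserving_fiber {β : ℝ} (hβ : β ≠ 0) (y : UnitAddCircle) :
    Measure.QuasiMeasurePreserving
      (fun x : UnitAddCircle => ((β * rep x : ℝ) : UnitAddCircle) + y) volume volume := by
  have h1 : Measure.QuasiMeasurePreserving (fun x : ℝ => β * x) volume volume :=
    Measure.quasiMeasurePreserving_smul volume hβ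
  exact (measurePreserving_add_right volume y).quasiMeasurePreserving.comp
    (quasiMeasurePreserving_coe.comp (h1.comp quasiMeasurePreserving_rep))

theorem measurable_affineMap (β : ℝ) : Measurable (affineMap β) := by
  have h : affineMap β = fun z => (((β * rep z.1 : ℝ) : UnitAddCircle) + z.2, z.2 + z.2) :=
    funext (affineMap_eq β)
  rw [h]
  have hm : Measurable (fun x : ℝ => (x : UnitAddCircle)) :=
    (UnitAddCircle.measurePreserving_mk 0).measurable
  have h1 : Measurable fun z : Torus => ((β * rep z.1 : ℝ) : UnitAddCircle) :=
    hm.comp ((measurable_rep.comp measurable_fst).const_mul β)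
  exact (h1.add measurable_snd).prodMk (measurable_snd.add measurable_snd)

/-- Fubini over horizontal circles: the slice at height `y` of the preimage is the preimage, under a
nonsingular circle map, of the slice at height `2y`, and doubling preserves Lebesgue measure. -/
theorem quasiMeasurePreserving_affineMap {β : ℝ} (hβ : β ≠ 0) :
    Measure.QuasiMeasurePreserving (affineMap β) volume volume := by
  refine ⟨measurable_affineMap β, Measure.AbsolutelyContinuous.mk fun N hN h0 => ?_⟩
  have hslice : ∀ S : Set Torus, MeasurableSet S →
      (volume S = 0 ↔ ∀ᵐ y : UnitAddCircle, volume ((fun x => ((x, y) : Torus)) ⁻¹' S) = 0) := by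
    intro S hS
    rw [Measure.volume_eq_prod, Measure.prod_apply_symm hS,
      lintegral_eq_zero_iff (measurable_measure_prodMk_right hS)]
    rfl
  rw [Measure.map_apply (measurable_affineMap β) hN, hslice _ (measurable_affineMap β hN)]
  have h2 : Measure.QuasiMeasurePreserving (fun y : UnitAddCircle => (2 : ℤ) • y) volume volume :=
    (Measure.measurePreserving_zsmul volume two_ne_zero).quasiMeasurePreserving
  filter_upwards [h2.ae ((hslice N hN).1 h0)] with y hy
  rw [two_zsmul] at hy
  have h3 := (quasiMeasurePreserving_fiber hβ y).preimage_null hy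
  refine measure_mono_null (fun x hx => ?_) h3
  have hx' : affineMap β (x, y) ∈ N := hx
  rwa [affineMap_eq] at hx'

/-! ### Local behaviour along orbits -/

theorem isOpenMap_proj : IsOpenMap proj := by
  have h1 : IsOpenMap fun p : ℝ × ℝ => ((p.1 : UnitAddCircle), (p.2 : UnitAddCircle)) :=
    (QuotientAddGroup.isOpenMap_coe).prodMap (QuotientAddGroup.isOpenMap_coe)
  have h2 : IsOpenMap fun v : Plane => (v 0, v 1) :=
    ((EuclideanSpace.equiv (Fin 2) ℝ).toHomeomorph.trans
      (Homeomorph.finTwoArrow (X := ℝ))).isOpenMap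
  exact h1.comp h2

theorem map_add_proj_nhds (z : Torus) : map (fun v => z + proj v) (𝓝 0) = 𝓝 z := by
  have hc : Continuous fun v => z + proj v := continuous_const.add continuous_proj
  have ho : IsOpenMap fun v => z + proj v := (isOpenMap_add_left z).comp isOpenMap_proj
  have h := (ho.nhds_le 0).antisymm (hc.tendsto 0)
  simpa using h.symm

theorem eventually_affineMap_add_proj (β : ℝ) {z : Torus} (hz : z ∉ cutCurve) :
    ∀ᶠ v in 𝓝 (0 : Plane), affineMap β (z + proj v) = affineMap β z + proj (linPart β v) := by
  have h0 : 0 < rep z.1 := by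
    refine lt_of_le_of_ne (rep_mem z.1).1 fun h => hz ?_
    change z.1 = 0
    rw [← rep_coe z.1, ← h, AddCircle.coe_zero]
  have hc : Tendsto (fun v : Plane => rep z.1 + v 0) (𝓝 0) (𝓝 (rep z.1 + (0 : Plane) 0)) :=
    (by fun_prop : Continuous fun v : Plane => rep z.1 + v 0).tendsto 0
  have hmem : Set.Ioo (0 : ℝ) 1 ∈ 𝓝 (rep z.1 + (0 : Plane) 0) := by
    refine Ioo_mem_nhds ?_ ?_
    · simpa using h0
    · simpa using (rep_mem z.1).2
  filter_upwards [hc hmem] with v hv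
  rw [affineMap_add_proj (rep_coe z.1).symm ⟨hv.1.le, hv.2⟩, affineMap_eq]

theorem tendsto_linPart_pow (β : ℝ) (n : ℕ) :
    Tendsto (fun v : Plane => (linPart β ^ n) v) (𝓝 0) (𝓝 0) := by
  simpa using (linPart β ^ n).continuous.tendsto 0

theorem eventually_iterate_affineMap_add_proj (β : ℝ) {z : Torus} {n : ℕ}
    (hz : ∀ k < n, (affineMap β)^[k] z ∉ cutCurve) :
    ∀ᶠ v in 𝓝 (0 : Plane), (affineMap β)^[n] (z + proj v)
      = (affineMap β)^[n] z + proj ((linPart β ^ n) v) := by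
  induction n with
  | zero => exact Eventually.of_forall fun v => rfl
  | succ n ih =>
    filter_upwards [ih fun k hk => hz k (by omega), (tendsto_linPart_pow β n).eventually
      (eventually_affineMap_add_proj β (hz n n.lt_succ_self))] with v h1 h2
    rw [Function.iterate_succ_apply' _ n, Function.iterate_succ_apply' _ n, h1, h2, pow_succ']
    rfl

section Cylinders

variable {β : ℝ} {Ω : Set (Set Torus)} {n : ℕ} {C C' : Set Torus} {z : Torus}

theorem cylinders_eq_of_mem {F : Torus → Torus} (hΩ : Ω.PairwiseDisjoint id)
    (hC : C ∈ cylinders F Ω n) (hC' : C' ∈ cylinders F Ω n) (hz : z ∈ C) (hz' : z ∈ C') :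
    C = C' := by
  obtain ⟨-, w, hw, rfl⟩ := hC
  obtain ⟨-, w', hw', rfl⟩ := hC'
  have h : w = w' := funext fun k =>
    hΩ.elim_set (hw k) (hw' k) _ (Set.mem_iInter.1 hz k) (Set.mem_iInter.1 hz' k)
  rw [h]

theorem notMem_cutCurve_of_mem_cylinders (hΩ : IsPolygonalPartition (affineMap β) Ω)
    (hC : C ∈ cylinders (affineMap β) Ω n) (hz : z ∈ C) :
    ∀ k < n, (affineMap β)^[k] z ∉ cutCurve := by
  obtain ⟨-, w, hw, rfl⟩ := hC
  exact fun k hk => (hΩ.avoids _ (hw ⟨k, hk⟩)).notMem_of_mem_left (Set.mem_iInter.1 hz ⟨k, hk⟩)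

/-- F_A is not continuous, but orbits starting in a cylinder avoid Γ up to time `n`, so the iterates
involved are locally affine there. -/
theorem isOpen_of_mem_cylinders (hΩ : IsPolygonalPartition (affineMap β) Ω)
    (hC : C ∈ cylinders (affineMap β) Ω n) : IsOpen C := by
  rw [isOpen_iff_mem_nhds]
  intro z hz
  have hcut := notMem_cutCurve_of_mem_cylinders hΩ hC hz
  obtain ⟨-, w, hw, rfl⟩ := hC
  refine iInter_mem.2 fun k => ?_
  have hk := eventually_iterate_affineMap_add_proj β (fun j (hj : j < k) => hcut j (by omega))
  have ht : Tendsto (fun v => (affineMap β)^[k] z + proj ((linPart β ^ (k : ℕ)) v)) (𝓝 0)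
      (𝓝 ((affineMap β)^[k] z)) := by
    rw [← map_add_proj_nhds ((affineMap β)^[k] z)]
    exact tendsto_map.comp (tendsto_linPart_pow β k)
  rw [← map_add_proj_nhds z, mem_map]
  filter_upwards [hk, ht ((hΩ.isOpen _ (hw k)).mem_nhds (Set.mem_iInter.1 hz k))] with v h1 h2
  change (affineMap β)^[k] (z + proj v) ∈ w k
  rw [h1]
  exact h2

theorem derivOn_iterate_affineMap (hz : ∀ k < n, (affineMap β)^[k] z ∉ cutCurve)
    (hC : C ∈ 𝓝 z) : derivOn (affineMap β)^[n] C z = linPart β ^ n := by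
  have hs : {v | z + proj v ∈ C} ∈ 𝓝 (0 : Plane) := by
    rw [← map_add_proj_nhds z] at hC
    exact hC
  refine HasTorusFDerivWithinAt.torusFDerivWithin (uniqueDiffWithinAt_of_mem_nhds hs)
    (hasTorusFDerivWithinAt_of_affine (y := (affineMap β)^[n] z) ?_)
  exact (eventually_iterate_affineMap_add_proj β hz).filter_mono nhdsWithin_le_nhds

theorem ae_exists_mem_cylinders (hβ : β ≠ 0) (hΩ : IsPolygonalPartition (affineMap β) Ω) (n : ℕ) :
    ∀ᵐ z : Torus, ∃ C ∈ cylinders (affineMap β) Ω n, z ∈ C := by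
  have h : ∀ k : ℕ, ∀ᵐ z : Torus, (affineMap β)^[k] z ∈ ⋃₀ Ω := fun k =>
    ((quasiMeasurePreserving_affineMap hβ).iterate k).ae (mem_ae_iff.2 hΩ.full)
  filter_upwards [ae_all_iff.2 h] with z hz
  choose w hw hzw using hz
  have hmem : z ∈ ⋂ k : Fin n, (affineMap β)^[k] ⁻¹' w k := Set.mem_iInter.2 fun k => hzw k
  exact ⟨_, ⟨⟨z, hmem⟩, fun k => w k, fun k => hw k, rfl⟩, hmem⟩

/-- A cylinder with `z` in its closure meets the open cylinder `C` around `z`, hence equals `C`: the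
infimum over cylinders has a single term. -/
theorem minExpansion_eq_of_mem (hΩ : IsPolygonalPartition (affineMap β) Ω)
    (hC : C ∈ cylinders (affineMap β) Ω n) (hz : z ∈ C) :
    minExpansion (affineMap β) Ω n z
      = ⨅ (v : Plane) (_ : ‖v‖ = 1), ‖(linPart β ^ n) v‖ₑ := by
  have hd := derivOn_iterate_affineMap (notMem_cutCurve_of_mem_cylinders hΩ hC hz)
    ((isOpen_of_mem_cylinders hΩ hC).mem_nhds hz)
  refine le_antisymm ?_ (le_iInf₂ fun C' hC' => le_iInf fun hz' => ?_)
  · refine (iInf₂_le C hC).trans ((iInf_le _ (subset_closure hz)).trans ?_)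
    rw [hd]
  · obtain ⟨p, hp, hp'⟩ := mem_closure_iff.1 hz' C (isOpen_of_mem_cylinders hΩ hC) hz
    rw [← cylinders_eq_of_mem hΩ.disjoint hC hC' hp hp', hd]

theorem hasLambdaBar_affineMap_const (hβ : 1 < β) (h2 : β ≠ 2)
    (hΩ : IsPolygonalPartition (affineMap β) Ω)
    (hent : HasMultiplicityEntropy (affineMap β) Ω 0) {c : ℂ} (hc : c ≠ 0) :
    HasLambdaBar (affineMap β) (fun _ => c) Ω (ENNReal.ofReal (‖c‖ * max 2 β)) := by
  refine ⟨0, _, hent, ?_, by rw [Real.exp_zero, ENNReal.ofReal_one, one_mul]⟩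
  have hc' : 0 < ‖c‖ := norm_pos_iff.2 hc
  have hm : 0 < min 2 β := lt_min two_pos (by linarith)
  have hprod : 2 * β = min 2 β * max 2 β := (min_mul_max 2 β).symm
  set K : ℕ → ℝ≥0∞ := fun n => ⨅ (v : Plane) (_ : ‖v‖ = 1), ‖(linPart β ^ n) v‖ₑ with hK
  have hess : ∀ n : ℕ, essSup (fun z : Torus => ‖weightProd (affineMap β) (fun _ => c) n z‖ₑ *
      ‖(derivOn (affineMap β)^[n] Set.univ z).det‖ₑ * (minExpansion (affineMap β) Ω n z)⁻¹) volume
        = ENNReal.ofReal (‖c‖ ^ n * (2 * β) ^ n) * (K n)⁻¹ := by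
    intro n
    have hae : (fun z : Torus => ‖weightProd (affineMap β) (fun _ => c) n z‖ₑ *
        ‖(derivOn (affineMap β)^[n] Set.univ z).det‖ₑ * (minExpansion (affineMap β) Ω n z)⁻¹)
          =ᵐ[volume] fun _ => ENNReal.ofReal (‖c‖ ^ n * (2 * β) ^ n) * (K n)⁻¹ := by
      filter_upwards [ae_exists_mem_cylinders (by linarith) hΩ n] with z ⟨C, hC, hz⟩
      rw [minExpansion_eq_of_mem hΩ hC hz, derivOn_iterate_affineMap
        (notMem_cutCurve_of_mem_cylinders hΩ hC hz) univ_mem, det_linPart_pow, weightProd_const,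
        ← ofReal_norm, ← ofReal_norm, ← ENNReal.ofReal_mul (norm_nonneg _), norm_pow, norm_pow,
        Real.norm_of_nonneg (by linarith : 0 ≤ 2 * β)]
    rw [essSup_congr_ae hae, essSup_const _ (NeZero.ne _)]
  simp only [hess]
  obtain ⟨a, ha, hbound⟩ := exists_le_norm_linPart_pow hβ h2
  obtain ⟨v, hv, hveq⟩ := exists_unit_linPart_pow_eq_smul h2
  have hKle : ∀ n, K n ≤ ENNReal.ofReal (min 2 β ^ n) := by
    intro n
    refine (iInf₂_le v hv).trans ?_
    rw [hveq, ← ofReal_norm, norm_smul, hv, mul_one, Real.norm_of_nonneg (by positivity)]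
  have hleK : ∀ n, ENNReal.ofReal (a * min 2 β ^ n) ≤ K n := by
    intro n
    refine le_iInf₂ fun u hu => ?_
    rw [← ofReal_norm]
    refine ENNReal.ofReal_le_ofReal ?_
    simpa [hu] using hbound n u
  refine tendsto_root_of_bounds (c := 1) (C := a⁻¹) one_pos (by positivity) (by positivity) ?_ ?_
  · intro n
    calc ENNReal.ofReal (1 * (‖c‖ * max 2 β) ^ n)
        = ENNReal.ofReal (‖c‖ ^ n * (2 * β) ^ n * (min 2 β ^ n)⁻¹) := by
          congr 1
          rw [hprod]
          field_simp
          ring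
      _ = ENNReal.ofReal (‖c‖ ^ n * (2 * β) ^ n) * (ENNReal.ofReal (min 2 β ^ n))⁻¹ := by
          rw [ENNReal.ofReal_mul (by positivity), ENNReal.ofReal_inv_of_pos (by positivity)]
      _ ≤ _ := by
          gcongr
          exact hKle n
  · intro n
    calc ENNReal.ofReal (‖c‖ ^ n * (2 * β) ^ n) * (K n)⁻¹
        ≤ ENNReal.ofReal (‖c‖ ^ n * (2 * β) ^ n) * (ENNReal.ofReal (a * min 2 β ^ n))⁻¹ := by
          gcongr
          exact hleK n
      _ = ENNReal.ofReal (‖c‖ ^ n * (2 * β) ^ n * (a * min 2 β ^ n)⁻¹) := by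
          rw [ENNReal.ofReal_mul (by positivity : 0 ≤ ‖c‖ ^ n * (2 * β) ^ n),
            ENNReal.ofReal_inv_of_pos (by positivity)]
      _ = ENNReal.ofReal (a⁻¹ * (‖c‖ * max 2 β) ^ n) := by
          congr 1
          rw [hprod]
          field_simp
          ring

end Cylinders

/-! ### Counting the sectors cut out by finitely many lines -/

theorem plane_eq_smul_add_smul (v : Plane) : v = v 0 • (!₂[1, 0] : Plane) + v 1 • vert := by
  ext i
  fin_cases i <;> simp [vert]

/-- On either open half-plane `v 1 > 0` or `v 1 < 0`, the quotient `ℓ v / |v 1|` is a nondecreasing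
affine function of `v 0 / |v 1|`. -/
theorem pos_of_slope_le {ℓ : Plane →ₗ[ℝ] ℝ} (hℓ : 0 ≤ ℓ !₂[1, 0]) {v v' : Plane}
    (hv : v 1 ≠ 0) (hv' : v' 1 ≠ 0) (hs : 0 < v 1 ↔ 0 < v' 1)
    (hle : v 0 / |v 1| ≤ v' 0 / |v' 1|) (h : 0 < ℓ v) : 0 < ℓ v' := by
  have key : ∀ u : Plane, u 1 ≠ 0 →
      ℓ u / |u 1| = u 0 / |u 1| * ℓ !₂[1, 0] + u 1 / |u 1| * ℓ vert := by
    intro u hu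
    have h : ℓ u = u 0 * ℓ !₂[1, 0] + u 1 * ℓ vert := by
      conv_lhs => rw [plane_eq_smul_add_smul u]
      simp only [map_add, map_smul, smul_eq_mul]
    rw [h]
    ring
  have hsign : v 1 / |v 1| = v' 1 / |v' 1| := by
    rcases lt_or_gt_of_ne hv with h1 | h1
    · have h2 : v' 1 < 0 := lt_of_le_of_ne (not_lt.1 fun h => h1.not_gt (hs.2 h)) hv'
      rw [abs_of_neg h1, abs_of_neg h2, div_neg, div_neg, div_self hv, div_self hv']
    · rw [abs_of_pos h1, abs_of_pos (hs.1 h1), div_self hv, div_self hv']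
  have h1 : 0 < ℓ v / |v 1| := div_pos h (abs_pos.2 hv)
  have h2 : 0 < ℓ v' / |v' 1| := by
    rw [key v hv] at h1
    rw [key v' hv', ← hsign]
    have := mul_le_mul_of_nonneg_right hle hℓ
    linarith
  exact (div_pos_iff_of_pos_right (abs_pos.2 hv')).1 h2

/-- On each half-plane the sets of positive forms increase with `v 0 / |v 1|`. Being a chain, they
are determined by their cardinality, which takes at most `#ι + 1` values. -/
theorem ncard_le_of_signs_of_nonneg {κ ι : Type*} [Fintype ι] {ℓ : ι → Plane →ₗ[ℝ] ℝ}
    (hℓ : ∀ i, 0 ≤ ℓ i !₂[1, 0]) {S : Set κ} {v : κ → Plane} (hv : ∀ c ∈ S, v c 1 ≠ 0)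
    (hinj : ∀ c ∈ S, ∀ c' ∈ S, (∀ i, 0 < ℓ i (v c) ↔ 0 < ℓ i (v c')) → c = c') :
    S.ncard ≤ 2 * (Fintype.card ι + 1) := by
  classical
  set P : κ → Finset ι := fun c => Finset.univ.filter fun i => 0 < ℓ i (v c) with hP
  set key : κ → Bool × ℕ := fun c => (decide (0 < v c 1), (P c).card) with hkey
  have hcard : ((Finset.univ ×ˢ Finset.range (Fintype.card ι + 1) : Finset (Bool × ℕ)) :
      Set (Bool × ℕ)).ncard = 2 * (Fintype.card ι + 1) := by
    rw [Set.ncard_coe_finset, Finset.card_product, Finset.card_range, Finset.card_univ,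
      Fintype.card_bool]
  rw [← hcard]
  refine Set.ncard_le_ncard_of_injOn key (fun c _ => ?_) ?_ (Finset.finite_toSet _)
  · exact Finset.mem_coe.2 (Finset.mem_product.2 ⟨Finset.mem_univ _,
      Finset.mem_range.2 (Nat.lt_succ_of_le (Finset.card_le_univ (P c)))⟩)
  · have main : ∀ c ∈ S, ∀ c' ∈ S, key c = key c' →
        v c 0 / |v c 1| ≤ v c' 0 / |v c' 1| → c = c' := by
      intro c hc c' hc' h hle
      have hs : 0 < v c 1 ↔ 0 < v c' 1 := decide_eq_decide.1 (congrArg Prod.fst h)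
      have hsub : P c ⊆ P c' := by
        intro i hi
        simp only [hP, Finset.mem_filter, Finset.mem_univ, true_and] at hi ⊢
        exact pos_of_slope_le (hℓ i) (hv c hc) (hv c' hc') hs hle hi
      have heq : P c = P c' :=
        Finset.eq_of_subset_of_card_le hsub (congrArg Prod.snd h).ge
      refine hinj c hc c' hc' fun i => ?_
      simpa [hP] using Finset.ext_iff.1 heq i
    intro c hc c' hc' h
    rcases le_total (v c 0 / |v c 1|) (v c' 0 / |v c' 1|) with hle | hle
    · exact main c hc c' hc' h hle
    · exact (main c' hc' c hc h.symm hle).symm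

/-- The lines `ker ℓ_i` cut the plane into at most `2 (#ι + 1)` sectors. -/
theorem ncard_le_of_signs {κ ι : Type*} [Fintype ι] {ℓ : ι → Plane →ₗ[ℝ] ℝ} {S : Set κ}
    {v : κ → Plane} (hv : ∀ c ∈ S, v c 1 ≠ 0) (hℓ : ∀ c ∈ S, ∀ i, ℓ i (v c) ≠ 0)
    (hinj : ∀ c ∈ S, ∀ c' ∈ S, (∀ i, 0 < ℓ i (v c) ↔ 0 < ℓ i (v c')) → c = c') :
    S.ncard ≤ 2 * (Fintype.card ι + 1) := by
  classical
  -- Normalize signs. As no form vanishes at the chosen vectors, negating one merely exchanges its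
  -- two signs, and sign patterns still separate.
  set ℓ' : ι → Plane →ₗ[ℝ] ℝ := fun i => if 0 ≤ ℓ i !₂[1, 0] then ℓ i else -ℓ i with hℓ'
  refine ncard_le_of_signs_of_nonneg (ℓ := ℓ') (fun i => ?_) hv fun c hc c' hc' h => ?_
  · by_cases h : 0 ≤ ℓ i !₂[1, 0]
    · simp [hℓ', h]
    · simp only [hℓ', h, if_false, LinearMap.neg_apply]
      linarith
  · refine hinj c hc c' hc' fun i => ?_
    have hi := h i
    by_cases h0 : 0 ≤ ℓ i !₂[1, 0]
    · simpa [hℓ', h0] using hi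
    · simp only [hℓ', h0, if_false, LinearMap.neg_apply, neg_pos] at hi
      have h1 := hℓ c hc i
      have h2 := hℓ c' hc' i
      rw [← not_iff_not, not_lt, not_lt, le_iff_lt_or_eq, le_iff_lt_or_eq]
      simpa [h1, h2] using hi

/-- Finitely many lines have measure zero, whereas nonempty open sets have positive measure. -/
theorem exists_mem_forall_ne_zero {ι : Type*} [Finite ι] {ℓ : ι → Plane →ₗ[ℝ] ℝ}
    (hℓ : ∀ i, ℓ i ≠ 0) {U : Set Plane} (hU : IsOpen U) (hne : U.Nonempty) :
    ∃ v ∈ U, ∀ i, ℓ i v ≠ 0 := by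
  have h0 : volume (⋃ i, (LinearMap.ker (ℓ i) : Set Plane)) = 0 :=
    measure_iUnion_null fun i => Measure.addHaar_submodule _ _ fun h =>
      hℓ i (LinearMap.ker_eq_top.1 h)
  by_contra! hcon
  refine (hU.measure_pos volume hne).ne' (measure_mono_null (fun v hv => ?_) h0)
  obtain ⟨i, hi⟩ := hcon v hv
  exact Set.mem_iUnion.2 ⟨i, hi⟩

/-- The linear form whose kernel is the line spanned by `d` (when `d ≠ 0`). -/
noncomputable def cross (d : Plane) : Plane →ₗ[ℝ] ℝ :=
  d 0 • (EuclideanSpace.proj (1 : Fin 2) : Plane →L[ℝ] ℝ).toLinearMap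
    - d 1 • (EuclideanSpace.proj (0 : Fin 2) : Plane →L[ℝ] ℝ).toLinearMap

theorem cross_apply (d v : Plane) : cross d v = d 0 * v 1 - d 1 * v 0 := rfl

theorem cross_vert (v : Plane) : cross vert v = -v 0 := by
  simp [cross_apply, vert]

theorem cross_ne_zero {d : Plane} (hd : d ≠ 0) : cross d ≠ 0 := by
  intro h
  apply hd
  have h1 : d 0 * d 0 - d 1 * -d 1 = 0 := by
    have := LinearMap.congr_fun h !₂[-d 1, d 0]
    simpa [cross_apply] using this
  have h2 : d 0 = 0 := by nlinarith [mul_self_nonneg (d 0), mul_self_nonneg (d 1)]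
  have h3 : d 1 = 0 := by nlinarith [mul_self_nonneg (d 0), mul_self_nonneg (d 1)]
  ext i
  fin_cases i
  · exact h2
  · exact h3

theorem vert_ne_zero : vert ≠ 0 := fun h => by
  simpa [h] using norm_vert

/-! ### Germs of projected segments -/

/-- Compactness of the parameter interval localizes the claim at a parameter `t₀`. If the segment
passes through `y` there, the two small lifts must coincide; otherwise it stays away from `y`
nearby. -/
theorem eventually_mem_proj_segment (p q : Plane) (y : Torus) :
    ∀ᶠ v in 𝓝 (0 : Plane), y + proj v ∈ proj '' segment ℝ p q → ∃ t : ℝ, v = t • (q - p) := by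
  have h : ∀ᶠ v in 𝓝 (0 : Plane), ∀ t ∈ Set.Icc (0 : ℝ) 1,
      y + proj v = proj (p + t • (q - p)) → ∃ t : ℝ, v = t • (q - p) := by
    refine isCompact_Icc.eventually_forall_of_forall_eventually fun t₀ _ => ?_
    by_cases hy : y = proj (p + t₀ • (q - p))
    · have hc : Continuous fun z : Plane × ℝ => z.1 - (z.2 - t₀) • (q - p) := by fun_prop
      have ht := hc.tendsto ((0 : Plane), t₀)
      simp only [sub_self, zero_smul] at ht
      filter_upwards [ht (Metric.ball_mem_nhds 0 one_pos)] with z hz hzy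
      refine ⟨z.2 - t₀, sub_eq_zero.1 (eq_zero_of_proj_eq_zero ?_ (mem_ball_zero_iff.1 hz))⟩
      have h1 : z.1 - (z.2 - t₀) • (q - p)
          = ((p + t₀ • (q - p)) + z.1) - (p + z.2 • (q - p)) := by
        rw [sub_smul]; abel
      rw [h1, proj_sub, proj_add _ z.1, ← hy, hzy, sub_self]
    · have hc : Continuous fun z : Plane × ℝ => y + proj z.1 - proj (p + z.2 • (q - p)) :=
        (continuous_const.add (continuous_proj.comp continuous_fst)).sub
          (continuous_proj.comp (by fun_prop))
      have hne : y + proj ((0 : Plane), t₀).1 - proj (p + ((0 : Plane), t₀).2 • (q - p)) ≠ 0 := by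
        simpa [sub_eq_zero] using hy
      filter_upwards [hc.continuousAt.eventually_ne hne] with z hz hzy
      exact absurd (sub_eq_zero.2 hzy) hz
  filter_upwards [h] with v hv hmem
  rw [segment_eq_image'] at hmem
  obtain ⟨_, ⟨t, ht, rfl⟩, hyt⟩ := hmem
  exact hv t ht hyt.symm

/-- Finitely many directions account for the germs of the boundaries of a polygonal partition. -/
theorem IsPolygonalPartition.exists_directions {F : Torus → Torus} {Ω : Set (Set Torus)}
    (hΩ : IsPolygonalPartition F Ω) :
    ∃ E : Finset Plane, vert ∈ E ∧ (∀ d ∈ E, d ≠ 0) ∧ ∀ ω ∈ Ω, ∀ y : Torus,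
      ∀ᶠ v in 𝓝 (0 : Plane), y + proj v ∈ frontier ω → ∃ d ∈ E, cross d v = 0 := by
  classical
  choose! S hSfin hS using hΩ.polygonal
  -- A degenerate segment contributes only `v = 0`, so any nonzero direction serves for it.
  set dir : Plane × Plane → Plane := fun p => if p.2 - p.1 = 0 then vert else p.2 - p.1 with hdir
  have hfin : (⋃ ω ∈ Ω, dir '' S ω).Finite :=
    hΩ.finite.biUnion fun ω hω => (hSfin ω hω).image dir
  refine ⟨insert vert hfin.toFinset, Finset.mem_insert_self _ _, ?_, ?_⟩
  · intro d hd
    rcases Finset.mem_insert.1 hd with rfl | hd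
    · exact vert_ne_zero
    · simp only [Set.Finite.mem_toFinset, Set.mem_iUnion] at hd
      obtain ⟨ω, -, p, -, rfl⟩ := hd
      by_cases h : p.2 - p.1 = 0
      · simpa [hdir, h] using vert_ne_zero
      · simp [hdir, h]
  · intro ω hω y
    filter_upwards [((hSfin ω hω).eventually_all).2 fun p _ =>
      eventually_mem_proj_segment p.1 p.2 y] with v hv hmem
    obtain ⟨p, hp, hpv⟩ := Set.mem_iUnion₂.1 (hS ω hω hmem)
    obtain ⟨t, rfl⟩ := hv p hp hpv
    refine ⟨dir p, Finset.mem_insert_of_mem (hfin.mem_toFinset.2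
      (Set.mem_biUnion hω (Set.mem_image_of_mem dir hp))), ?_⟩
    by_cases h : p.2 - p.1 = 0
    · simp [h]
    · simp only [hdir, h, if_false, map_smul, smul_eq_mul]
      rw [cross_apply]
      ring

/-! ### One-sided germs of the map -/

theorem exists_affineMap_add_proj_of_pos (β : ℝ) (y : Torus) :
    ∃ y' : Torus, ∀ᶠ w in 𝓝 (0 : Plane), 0 < w 0 →
      affineMap β (y + proj w) = y' + proj (linPart β w) := by
  obtain ⟨h0, h1⟩ := rep_mem y.1
  refine ⟨(((β * rep y.1 : ℝ) : UnitAddCircle) + y.2, y.2 + y.2), ?_⟩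
  have hc : Tendsto (fun w : Plane => rep y.1 + w 0) (𝓝 0) (𝓝 (rep y.1 + (0 : Plane) 0)) :=
    (by fun_prop : Continuous fun w : Plane => rep y.1 + w 0).tendsto 0
  filter_upwards [hc (Iio_mem_nhds (show rep y.1 + (0 : Plane) 0 < 1 by simpa using h1))]
    with w hw hpos
  exact affineMap_add_proj (rep_coe y.1).symm ⟨by linarith, hw⟩

theorem exists_affineMap_add_proj_of_neg (β : ℝ) (y : Torus) :
    ∃ y' : Torus, ∀ᶠ w in 𝓝 (0 : Plane), w 0 < 0 →
      affineMap β (y + proj w) = y' + proj (linPart β w) := by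
  -- Approached from the left, a point of Γ has the lift 1 rather than 0.
  obtain ⟨c, hc0, hc1, hyc⟩ : ∃ c : ℝ, 0 < c ∧ c ≤ 1 ∧ y.1 = (c : UnitAddCircle) := by
    rcases (rep_mem y.1).1.eq_or_lt with h | h
    · refine ⟨1, one_pos, le_rfl, ?_⟩
      rw [← rep_coe y.1, ← h, AddCircle.coe_zero, AddCircle.coe_period]
    · exact ⟨_, h, (rep_mem y.1).2.le, (rep_coe y.1).symm⟩
  refine ⟨(((β * c : ℝ) : UnitAddCircle) + y.2, y.2 + y.2), ?_⟩
  have hc : Tendsto (fun w : Plane => c + w 0) (𝓝 0) (𝓝 (c + (0 : Plane) 0)) :=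
    (by fun_prop : Continuous fun w : Plane => c + w 0).tendsto 0
  filter_upwards [hc (Ioi_mem_nhds (show 0 < c + (0 : Plane) 0 by simpa using hc0))] with w hw hneg
  exact affineMap_add_proj hyc ⟨le_of_lt hw, by linarith⟩

/-! ### Multiplicity of the cylinders -/

section Multiplicity

variable {β : ℝ} {Ω : Set (Set Torus)} {n : ℕ} {E : Finset Plane}

/-- The linear forms vanishing on the preimages under `A^k`, `k < n`, of the directions in `E`. -/
noncomputable def pulledForm (β : ℝ) (E : Finset Plane) (n : ℕ) (i : E × Fin n) :
    Plane →ₗ[ℝ] ℝ :=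
  cross (i.1 : Plane) ∘ₗ (linPart β ^ (i.2 : ℕ)).toLinearMap

theorem pulledForm_ne_zero (hβ : β ≠ 0) (hE : ∀ d ∈ E, d ≠ 0) (i : E × Fin n) :
    pulledForm β E n i ≠ 0 := by
  intro h
  have hsurj : Function.Surjective (linPart β ^ (i.2 : ℕ)).toLinearMap :=
    LinearMap.injective_iff_surjective.1 (linPart_pow_injective hβ i.2)
  refine cross_ne_zero (hE i.1 i.1.2) (LinearMap.ext fun v => ?_)
  obtain ⟨u, rfl⟩ := hsurj v
  exact LinearMap.congr_fun h u

/-- The open sector on which exactly the forms `pulledForm β E n i` with `i ∈ P` are positive,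
the other ones being negative. -/
def sector (β : ℝ) (E : Finset Plane) (n : ℕ) (P : Set (E × Fin n)) : Set Plane :=
  {v | ∀ i, (i ∈ P → 0 < pulledForm β E n i v) ∧ (i ∉ P → pulledForm β E n i v < 0)}

theorem convex_sector (P : Set (E × Fin n)) : Convex ℝ (sector β E n P) := by
  intro u hu v hv a b ha hb hab i
  have hpos : 0 < a ∨ 0 < b := by
    rcases ha.eq_or_lt with h | h
    · right; linarith
    · exact Or.inl h
  simp only [map_add, map_smul, smul_eq_mul]
  refine ⟨fun hi => ?_, fun hi => ?_⟩
  · have h1 := (hu i).1 hi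
    have h2 := (hv i).1 hi
    rcases hpos with h | h
    · exact add_pos_of_pos_of_nonneg (mul_pos h h1) (mul_nonneg hb h2.le)
    · exact add_pos_of_nonneg_of_pos (mul_nonneg ha h1.le) (mul_pos h h2)
  · have h1 := (hu i).2 hi
    have h2 := (hv i).2 hi
    rcases hpos with h | h
    · exact add_neg_of_neg_of_nonpos (mul_neg_of_pos_of_neg h h1)
        (mul_nonpos_of_nonneg_of_nonpos hb h2.le)
    · exact add_neg_of_nonpos_of_neg (mul_nonpos_of_nonneg_of_nonpos ha h1.le)
        (mul_neg_of_pos_of_neg h h2)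

theorem pulledForm_ne_zero_of_mem_sector {P : Set (E × Fin n)} {v : Plane}
    (hv : v ∈ sector β E n P) (i : E × Fin n) : pulledForm β E n i v ≠ 0 := by
  by_cases hi : i ∈ P
  · exact ((hv i).1 hi).ne'
  · exact ((hv i).2 hi).ne

/-- On a small piece of a sector at `z`, the first `n` iterates of `F_A` are affine. -/
theorem exists_iterate_affineMap_sector (hvert : vert ∈ E) (z : Torus) (P : Set (E × Fin n))
    {k : ℕ} (hk : k ≤ n) :
    ∃ y : Torus, ∀ᶠ v in 𝓝 (0 : Plane), v ∈ sector β E n P →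
      (affineMap β)^[k] (z + proj v) = y + proj ((linPart β ^ k) v) := by
  induction k with
  | zero => exact ⟨z, Eventually.of_forall fun v _ => rfl⟩
  | succ k ih =>
    obtain ⟨y, hy⟩ := ih (by omega)
    -- The sign of this form tells on which side of the vertical line through `y` the k-th image
    -- lies, hence which one-sided branch applies if `y ∈ Γ`.
    set i : E × Fin n := (⟨vert, hvert⟩, ⟨k, hk⟩) with hi
    have hform : ∀ v, pulledForm β E n i v = -((linPart β ^ k) v) 0 := fun v => cross_vert _
    have hstep : ∃ y' : Torus, ∀ᶠ v in 𝓝 (0 : Plane), v ∈ sector β E n P →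
        affineMap β (y + proj ((linPart β ^ k) v))
          = y' + proj (linPart β ((linPart β ^ k) v)) := by
      by_cases hiP : i ∈ P
      · obtain ⟨y', hy'⟩ := exists_affineMap_add_proj_of_neg β y
        refine ⟨y', ?_⟩
        filter_upwards [(tendsto_linPart_pow β k).eventually hy'] with v hv hvs
        have := (hvs i).1 hiP
        rw [hform] at this
        exact hv (by linarith)
      · obtain ⟨y', hy'⟩ := exists_affineMap_add_proj_of_pos β y
        refine ⟨y', ?_⟩
        filter_upwards [(tendsto_linPart_pow β k).eventually hy'] with v hv hvs
        have := (hvs i).2 hiP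
        rw [hform] at this
        exact hv (by linarith)
    obtain ⟨y', hy'⟩ := hstep
    refine ⟨y', ?_⟩
    filter_upwards [hy, hy'] with v h1 h2 hvs
    rw [Function.iterate_succ_apply' _ k, h1 hvs, h2 hvs, pow_succ']
    rfl

/-- Off its frontier, the space splits into the disjoint open sets `ω` and `(closure ω)ᶜ`. -/
theorem mem_iff_mem_of_isPreconnected {X : Type*} [TopologicalSpace X] {s ω : Set X}
    (hs : IsPreconnected s) (hω : IsOpen ω) (hd : ∀ x ∈ s, x ∉ frontier ω) {x y : X}
    (hx : x ∈ s) (hy : y ∈ s) : x ∈ ω ↔ y ∈ ω := by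
  have hsub : s ⊆ ω ∪ (closure ω)ᶜ := by
    intro u hu
    by_cases h : u ∈ closure ω
    · left
      by_contra hu'
      exact hd u hu ⟨h, by rwa [hω.interior_eq]⟩
    · exact Or.inr h
  have hdis : Disjoint ω (closure ω)ᶜ :=
    Set.disjoint_compl_right_iff_subset.2 subset_closure
  have key : ∀ u ∈ s, u ∈ ω → s ⊆ ω := fun u hu huω =>
    hs.subset_left_of_subset_union hω isClosed_closure.isOpen_compl hdis hsub ⟨u, hu, huω⟩
  exact ⟨fun h => key x hx h hy, fun h => key y hy h hx⟩

/-- Points of a small piece of a sector at `z` have the same itinerary up to time `n`. -/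
theorem exists_ball_sector_itinerary (hΩ : IsPolygonalPartition (affineMap β) Ω)
    (hvert : vert ∈ E) (hE : ∀ ω ∈ Ω, ∀ y : Torus,
      ∀ᶠ v in 𝓝 (0 : Plane), y + proj v ∈ frontier ω → ∃ d ∈ E, cross d v = 0)
    (z : Torus) (P : Set (E × Fin n)) :
    ∀ᶠ r in 𝓝[>] (0 : ℝ), ∀ v ∈ sector β E n P ∩ Metric.ball 0 r,
      ∀ v' ∈ sector β E n P ∩ Metric.ball 0 r, ∀ k < n, ∀ ω ∈ Ω,
        ((affineMap β)^[k] (z + proj v) ∈ ω ↔ (affineMap β)^[k] (z + proj v') ∈ ω) := by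
  have hex : ∀ k : Fin n, ∃ y : Torus, ∀ᶠ v in 𝓝 (0 : Plane), v ∈ sector β E n P →
      (affineMap β)^[k] (z + proj v) = y + proj ((linPart β ^ (k : ℕ)) v) :=
    fun k => exists_iterate_affineMap_sector hvert z P k.2.le
  choose y hy using hex
  have hfr : ∀ᶠ v in 𝓝 (0 : Plane), ∀ k : Fin n, ∀ ω ∈ Ω, v ∈ sector β E n P →
      y k + proj ((linPart β ^ (k : ℕ)) v) ∉ frontier ω := by
    refine eventually_all.2 fun k => (hΩ.finite.eventually_all).2 fun ω hω => ?_
    filter_upwards [(tendsto_linPart_pow β k).eventually (hE ω hω (y k))] with v hv hvs hmem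
    obtain ⟨d, hd, h0⟩ := hv hmem
    exact pulledForm_ne_zero_of_mem_sector hvs (⟨d, hd⟩, k) h0
  obtain ⟨r₀, hr₀, hball⟩ := Metric.eventually_nhds_iff_ball.1 ((eventually_all.2 hy).and hfr)
  filter_upwards [Ioo_mem_nhdsGT hr₀] with r hr v hv v' hv' k hk ω hω
  have hsub : Metric.ball (0 : Plane) r ⊆ Metric.ball 0 r₀ := Metric.ball_subset_ball hr.2.le
  have hconn : IsPreconnected ((fun v => y ⟨k, hk⟩ + proj ((linPart β ^ k) v)) ''
      (sector β E n P ∩ Metric.ball 0 r)) := by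
    refine ((convex_sector P).inter (convex_ball 0 r)).isPreconnected.image _ ?_
    exact (continuous_const.add
      (continuous_proj.comp (linPart β ^ k).continuous)).continuousOn
  have h1 := (hball v (hsub hv.2)).1 ⟨k, hk⟩ hv.1
  have h2 := (hball v' (hsub hv'.2)).1 ⟨k, hk⟩ hv'.1
  rw [h1, h2]
  refine mem_iff_mem_of_isPreconnected hconn (hΩ.isOpen ω hω) ?_
    (Set.mem_image_of_mem _ hv) (Set.mem_image_of_mem _ hv')
  rintro _ ⟨u, hu, rfl⟩
  exact (hball u (hsub hu.2)).2 ⟨k, hk⟩ ω hω hu.1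

/-- Each cylinder accumulating at `z` contains a nearby point off all the lines. Two cylinders whose
points have the same signs share an itinerary and coincide, so there are no more cylinders than
sectors. -/
theorem ncard_cylinders_le (hβ : β ≠ 0) (hΩ : IsPolygonalPartition (affineMap β) Ω)
    (hvert : vert ∈ E) (hE0 : ∀ d ∈ E, d ≠ 0) (hE : ∀ ω ∈ Ω, ∀ y : Torus,
      ∀ᶠ v in 𝓝 (0 : Plane), y + proj v ∈ frontier ω → ∃ d ∈ E, cross d v = 0)
    (z : Torus) {S : Set (Set Torus)} (hS : S ⊆ cylinders (affineMap β) Ω n)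
    (hz : ∀ C ∈ S, z ∈ closure C) : S.ncard ≤ 2 * (E.card * n + 1) := by
  -- There are finitely many sign patterns `P`, so one radius works for all sectors.
  have hev := eventually_all.2 (exists_ball_sector_itinerary hΩ hvert hE z (n := n))
  obtain ⟨r, hr, hr0⟩ := (hev.and self_mem_nhdsWithin).exists
  have hr0' : 0 < r := hr0
  have hpt : ∀ C ∈ S, ∃ v : Plane, v ∈ Metric.ball 0 r ∧ z + proj v ∈ C ∧ v 1 ≠ 0 ∧
      ∀ i, pulledForm β E n i v ≠ 0 := by
    intro C hC
    have hC' := hS hC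
    have hcont : Continuous fun v => z + proj v := continuous_const.add continuous_proj
    have hopen : IsOpen (Metric.ball (0 : Plane) r ∩ (fun v => z + proj v) ⁻¹' C) :=
      Metric.isOpen_ball.inter ((isOpen_of_mem_cylinders hΩ hC').preimage hcont)
    have hne : (Metric.ball (0 : Plane) r ∩ (fun v => z + proj v) ⁻¹' C).Nonempty := by
      have himg : (fun v => z + proj v) '' Metric.ball 0 r ∈ 𝓝 z := by
        rw [← map_add_proj_nhds z]
        exact image_mem_map (Metric.ball_mem_nhds 0 hr0')
      obtain ⟨_, ⟨v, hv, rfl⟩, hvC⟩ := mem_closure_iff_nhds.1 (hz C hC) _ himg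
      exact ⟨v, hv, hvC⟩
    -- The additional form, vanishing on the horizontal line, secures `v 1 ≠ 0` for the sector
    -- count.
    set ℓ : Option (E × Fin n) → Plane →ₗ[ℝ] ℝ := fun i =>
      i.elim (cross !₂[1, 0]) (pulledForm β E n) with hℓ
    obtain ⟨v, hv, hv0⟩ := exists_mem_forall_ne_zero (ℓ := ℓ) (fun i => by
      cases i with
      | none => exact cross_ne_zero fun h => by simpa using congrArg (fun v : Plane => v 0) h
      | some i => exact pulledForm_ne_zero hβ hE0 i) hopen hne
    refine ⟨v, hv.1, hv.2, ?_, fun i => hv0 (some i)⟩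
    simpa [hℓ, cross_apply] using hv0 none
  choose! v hvr hvC hv1 hv0 using hpt
  have hcard : Fintype.card (E × Fin n) = E.card * n := by
    rw [Fintype.card_prod, Fintype.card_coe, Fintype.card_fin]
  rw [← hcard]
  refine ncard_le_of_signs hv1 hv0 fun C hC C' hC' hsign => ?_
  set P : Set (E × Fin n) := {i | 0 < pulledForm β E n i (v C)} with hP
  have hmem : v C ∈ sector β E n P := fun i =>
    ⟨fun hi => hi, fun hi => lt_of_le_of_ne (not_lt.1 hi) (hv0 C hC i)⟩
  have hmem' : v C' ∈ sector β E n P := fun i =>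
    ⟨fun hi => (hsign i).1 hi, fun hi =>
      lt_of_le_of_ne (not_lt.1 fun h => hi ((hsign i).2 h)) (hv0 C' hC' i)⟩
  have hCC : z + proj (v C') ∈ C := by
    have h0 := hvC C hC
    obtain ⟨-, w, hw, rfl⟩ := hS hC
    refine Set.mem_iInter.2 fun k => ?_
    exact (hr P _ ⟨hmem, hvr _ hC⟩ _ ⟨hmem', hvr _ hC'⟩ k k.2 (w k) (hw k)).1
      (Set.mem_iInter.1 h0 k)
  exact cylinders_eq_of_mem hΩ.disjoint (hS hC) (hS hC') hCC (hvC C' hC')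

theorem continuous_glue : Continuous glue :=
  ((AddCircle.continuous_mk' 1).comp (continuous_subtype_val.comp continuous_fst)).prodMk
    continuous_snd

/-- Gluing is continuous, so a closure taken in M maps into the closure in the torus, where the
count applies. -/
theorem exists_multiplicity_le (hβ : β ≠ 0) (hΩ : IsPolygonalPartition (affineMap β) Ω) :
    ∃ m : ℕ, ∀ n, multiplicity (affineMap β) Ω n ≤ 2 * (m * n + 1) := by
  obtain ⟨E, hvert, hE0, hE⟩ := hΩ.exists_directions
  refine ⟨E.card, fun n => ciSup_le' fun x => ?_⟩
  exact ncard_cylinders_le hβ hΩ hvert hE0 hE (glue x) (fun C hC => hC.1) fun C hC =>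
    continuous_glue.closure_preimage_subset C hC.2

theorem hasMultiplicityEntropy_zero (hβ : β ≠ 0) (hΩ : IsPolygonalPartition (affineMap β) Ω) :
    HasMultiplicityEntropy (affineMap β) Ω 0 := by
  obtain ⟨m, hm⟩ := exists_multiplicity_le hβ hΩ
  set K : ℝ := 2 * (m + 1) with hK
  have hK0 : 0 < K := by positivity
  have hlim : Tendsto (fun n : ℕ => 1 / (n : ℝ) * Real.log K + Real.log n / n) atTop (𝓝 0) := by
    have h1 := (tendsto_one_div_atTop_nhds_zero_nat (𝕜 := ℝ)).mul_const (Real.log K)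
    have h2 := Real.isLittleO_log_id_atTop.tendsto_div_nhds_zero.comp
      tendsto_natCast_atTop_atTop
    simpa using h1.add h2
  refine squeeze_zero' (Eventually.of_forall fun n => ?_) ?_ hlim
  · exact mul_nonneg (by positivity) (Real.log_natCast_nonneg _)
  · filter_upwards [eventually_ge_atTop 1] with n hn
    have hn1 : (1 : ℝ) ≤ n := by exact_mod_cast hn
    have hn0 : (0 : ℝ) < n := by linarith
    have hle : (multiplicity (affineMap β) Ω n : ℝ) ≤ K * n := by
      have h : (multiplicity (affineMap β) Ω n : ℝ) ≤ 2 * (m * n + 1) := by exact_mod_cast hm n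
      rw [hK]
      nlinarith
    have hlog : Real.log (multiplicity (affineMap β) Ω n) ≤ Real.log K + Real.log n := by
      rw [← Real.log_mul hK0.ne' hn0.ne']
      rcases Nat.eq_zero_or_pos (multiplicity (affineMap β) Ω n) with h0 | h0
      -- With `Real.log 0 = 0`, the bound here needs `K * n ≥ 1`.
      · rw [h0, Nat.cast_zero, Real.log_zero]
        refine Real.log_nonneg ?_
        have : (1 : ℝ) ≤ K := by
          rw [hK]
          have := Nat.cast_nonneg (α := ℝ) m
          linarith
        nlinarith
      · exact Real.log_le_log (by exact_mod_cast h0) hle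
    calc 1 / (n : ℝ) * Real.log (multiplicity (affineMap β) Ω n)
        ≤ 1 / (n : ℝ) * (Real.log K + Real.log n) := by gcongr
      _ = _ := by ring

end Multiplicity

/-! ### Existence of polygonal partitions -/

section Grid

variable {N : ℕ}

/-- The arc `(i/N, (i+1)/N)` of the circle. -/
def arc (N i : ℕ) : Set UnitAddCircle :=
  (fun x : ℝ => (x : UnitAddCircle)) '' Set.Ioo ((i : ℝ) / N) ((i + 1) / N)

theorem isOpen_arc (N i : ℕ) : IsOpen (arc N i) :=
  QuotientAddGroup.isOpenMap_coe _ isOpen_Ioo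

theorem mem_arc_iff {i : ℕ} (hi : i < N) {a : UnitAddCircle} :
    a ∈ arc N i ↔ (i : ℝ) < N * rep a ∧ N * rep a < i + 1 := by
  have hN : (0 : ℝ) < N := by exact_mod_cast (by omega : 0 < N)
  have hiff : ∀ x : ℝ, x ∈ Set.Ioo ((i : ℝ) / N) ((i + 1) / N) ↔
      (i : ℝ) < N * x ∧ N * x < i + 1 := fun x => by
    rw [Set.mem_Ioo, div_lt_iff₀' hN, lt_div_iff₀' hN]
  constructor
  · rintro ⟨x, hx, rfl⟩
    have hx' := (hiff x).1 hx
    have h0 : 0 ≤ x := (div_nonneg i.cast_nonneg hN.le).trans hx.1.le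
    have h1 : x < 1 := by
      have : (i : ℝ) + 1 ≤ N := by exact_mod_cast hi
      nlinarith
    simpa only [rep_coe_of_mem ⟨h0, h1⟩] using hx'
  · exact fun h => ⟨rep a, (hiff _).2 h, rep_coe a⟩

/-- The cell `(i, j)` of the `N × N` grid. -/
def cell (N : ℕ) (p : Fin N × Fin N) : Set Torus := arc N p.1 ×ˢ arc N p.2

theorem pairwiseDisjoint_range_cell (N : ℕ) : (Set.range (cell N)).PairwiseDisjoint id := by
  have harc : ∀ (i j : Fin N) (a : UnitAddCircle), a ∈ arc N i → a ∈ arc N j → i = j := by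
    intro i j a hi hj
    have h1 := (mem_arc_iff i.2).1 hi
    have h2 := (mem_arc_iff j.2).1 hj
    have h3 : (i : ℕ) < j + 1 := by exact_mod_cast h1.1.trans h2.2
    have h4 : (j : ℕ) < i + 1 := by exact_mod_cast h2.1.trans h1.2
    exact Fin.ext (by omega)
  rintro _ ⟨p, rfl⟩ _ ⟨q, rfl⟩ hne
  refine Set.disjoint_left.2 fun z hz hz' => hne ?_
  rw [Prod.ext (harc _ _ _ hz.1 hz'.1) (harc _ _ _ hz.2 hz'.2)]

/-- The points `i/N` of the circle. -/
def gridPoints (N : ℕ) : Set UnitAddCircle :=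
  Set.range fun i : Fin N => ((((i : ℕ) : ℝ) / N : ℝ) : UnitAddCircle)

theorem exists_mem_arc_of_notMem_gridPoints (hN : 0 < N) {a : UnitAddCircle}
    (ha : a ∉ gridPoints N) : ∃ i : Fin N, a ∈ arc N i := by
  have hN' : (0 : ℝ) < N := by exact_mod_cast hN
  obtain ⟨h0, h1⟩ := rep_mem a
  have hnn : 0 ≤ N * rep a := by positivity
  have hlt : ⌊N * rep a⌋₊ < N := (Nat.floor_lt hnn).2 (by nlinarith)
  refine ⟨⟨_, hlt⟩, (mem_arc_iff hlt).2 ⟨?_, Nat.lt_floor_add_one _⟩⟩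
  refine lt_of_le_of_ne (Nat.floor_le hnn) fun h => ha ⟨⟨_, hlt⟩, ?_⟩
  change (((⌊N * rep a⌋₊ : ℝ) / N : ℝ) : UnitAddCircle) = a
  rw [h, mul_div_cancel_left₀ _ hN'.ne', rep_coe]

theorem compl_sUnion_range_cell_subset (hN : 0 < N) :
    (⋃₀ Set.range (cell N))ᶜ ⊆ gridPoints N ×ˢ Set.univ ∪ Set.univ ×ˢ gridPoints N := by
  intro z hz
  by_contra hcon
  have h1 : z.1 ∉ gridPoints N := fun h => hcon (Or.inl ⟨h, trivial⟩)
  have h2 : z.2 ∉ gridPoints N := fun h => hcon (Or.inr ⟨trivial, h⟩)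
  obtain ⟨i, hi⟩ := exists_mem_arc_of_notMem_gridPoints hN h1
  obtain ⟨j, hj⟩ := exists_mem_arc_of_notMem_gridPoints hN h2
  exact hz ⟨_, ⟨(i, j), rfl⟩, hi, hj⟩

theorem frontier_subset_compl_sUnion {X : Type*} [TopologicalSpace X] {Ω : Set (Set X)}
    (ho : ∀ ω ∈ Ω, IsOpen ω) (hd : Ω.PairwiseDisjoint id) {ω : Set X} (hω : ω ∈ Ω) :
    frontier ω ⊆ (⋃₀ Ω)ᶜ := by
  rintro x hx ⟨ω', hω', hxω'⟩
  obtain ⟨y, hy', hy⟩ := mem_closure_iff.1 hx.1 ω' (ho ω' hω') hxω'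
  obtain rfl : ω = ω' := hd.elim_set hω hω' y hy hy'
  exact hx.2 (by rwa [(ho _ hω).interior_eq])

theorem grid_subset_segments (N : ℕ) : ∃ S : Set (Plane × Plane), S.Finite ∧
    (gridPoints N ×ˢ Set.univ ∪ Set.univ ×ˢ gridPoints N : Set Torus) ⊆
      ⋃ p ∈ S, proj '' segment ℝ p.1 p.2 := by
  set f : Fin N → Plane × Plane := fun i => (!₂[((i : ℕ) : ℝ) / N, 0], !₂[((i : ℕ) : ℝ) / N, 1])
    with hf
  set g : Fin N → Plane × Plane := fun i => (!₂[0, ((i : ℕ) : ℝ) / N], !₂[1, ((i : ℕ) : ℝ) / N])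
    with hg
  refine ⟨Set.range f ∪ Set.range g, (Set.finite_range f).union (Set.finite_range g), ?_⟩
  rintro ⟨a, b⟩ (⟨⟨i, hi⟩, -⟩ | ⟨-, ⟨i, hi⟩⟩)
  · refine Set.mem_biUnion (Or.inl ⟨i, rfl⟩) ⟨!₂[((i : ℕ) : ℝ) / N, rep b], ?_, ?_⟩
    · rw [segment_eq_image']
      refine ⟨rep b, Set.Ico_subset_Icc_self (rep_mem b), ?_⟩
      ext k
      fin_cases k <;> simp [hf]
    · exact Prod.ext hi (rep_coe b)
  · refine Set.mem_biUnion (Or.inr ⟨i, rfl⟩) ⟨!₂[rep a, ((i : ℕ) : ℝ) / N], ?_, ?_⟩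
    · rw [segment_eq_image']
      refine ⟨rep a, Set.Ico_subset_Icc_self (rep_mem a), ?_⟩
      ext k
      fin_cases k <;> simp [hg]
    · exact Prod.ext (rep_coe a) hi

/-- Multiplication by `γ ≤ N` stretches an arc of length `1/N` to length at most 1, and the arc is
open, so nothing wraps around. -/
theorem rep_eq_of_mul_coe_eq {i : ℕ} (hi : i < N) {γ : ℝ} (hγ : 0 < γ) (hγN : γ ≤ N)
    {a b : UnitAddCircle} (ha : a ∈ arc N i) (hb : b ∈ arc N i)
    (h : ((γ * rep a : ℝ) : UnitAddCircle) = ((γ * rep b : ℝ) : UnitAddCircle)) : a = b := by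
  obtain ⟨ha0, ha1⟩ := (mem_arc_iff hi).1 ha
  obtain ⟨hb0, hb1⟩ := (mem_arc_iff hi).1 hb
  have habs : |γ * rep a - γ * rep b| < 1 := by
    have h1 : |γ * rep a - γ * rep b| = γ * |rep a - rep b| := by
      rw [← mul_sub, abs_mul, abs_of_pos hγ]
    have h2 : (N : ℝ) * |rep a - rep b| < 1 := by
      rw [← abs_of_nonneg (Nat.cast_nonneg (α := ℝ) N), ← abs_mul, mul_sub, abs_lt]
      constructor <;> linarith
    rw [h1]
    exact (mul_le_mul_of_nonneg_right hγN (abs_nonneg _)).trans_lt h2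
  have h0 : γ * rep a - γ * rep b = 0 :=
    eq_zero_of_coe_eq_zero (by rw [AddCircle.coe_sub, h, sub_self]) habs
  have hrep : rep a = rep b := mul_left_cancel₀ hγ.ne' (sub_eq_zero.1 h0)
  rw [← rep_coe a, hrep, rep_coe]

theorem isPolygonalPartition_range_cell {β : ℝ} (hβ : 0 < β) (h2N : 2 ≤ N) (hβN : β ≤ N) :
    IsPolygonalPartition (affineMap β) (Set.range (cell N)) := by
  have hN : 0 < N := by omega
  have hopen : ∀ ω ∈ Set.range (cell N), IsOpen ω := by
    rintro _ ⟨p, rfl⟩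
    exact (isOpen_arc _ _).prod (isOpen_arc _ _)
  refine ⟨Set.finite_range _, hopen, pairwiseDisjoint_range_cell N, ?_, ?_, ?_, ?_⟩
  · have h0 : volume (gridPoints N) = 0 :=
      measure_mono_null (Set.subset_preimage_image rep _)
        (quasiMeasurePreserving_rep.preimage_null (((Set.finite_range _).image rep).measure_zero _))
    refine measure_mono_null (compl_sUnion_range_cell_subset hN) (measure_union_null ?_ ?_)
    · rw [Measure.volume_eq_prod, Measure.prod_prod, h0, zero_mul]
    · rw [Measure.volume_eq_prod, Measure.prod_prod, h0, mul_zero]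
  · rintro _ ⟨p, rfl⟩
    refine Set.disjoint_left.2 fun z hz hz0 => ?_
    have h := ((mem_arc_iff p.1.2).1 hz.1).1
    have hz0' : z.1 = ((0 : ℝ) : UnitAddCircle) := hz0
    rw [hz0', rep_coe_of_mem (by simp), mul_zero] at h
    exact h.not_ge (Nat.cast_nonneg _)
  · rintro _ ⟨p, rfl⟩ z hz z' hz' h
    rw [affineMap_eq, affineMap_eq] at h
    have hdouble : ∀ a : UnitAddCircle, a + a = ((2 * rep a : ℝ) : UnitAddCircle) := fun a => by
      rw [two_mul, AddCircle.coe_add, rep_coe]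
    -- The second coordinate comes first: once these agree, the shift by `y` in the first component
    -- cancels.
    have hsnd : z.2 = z'.2 := by
      refine rep_eq_of_mul_coe_eq p.2.2 two_pos (by exact_mod_cast h2N) hz.2 hz'.2 ?_
      rw [← hdouble, ← hdouble]
      exact congrArg Prod.snd h
    refine Prod.ext (rep_eq_of_mul_coe_eq p.1.2 hβ hβN hz.1 hz'.1 ?_) hsnd
    have hfst := congrArg Prod.fst h
    simp only [hsnd] at hfst
    exact add_right_cancel hfst
  · intro ω hω
    obtain ⟨S, hS, hsub⟩ := grid_subset_segments N
    exact ⟨S, hS, (frontier_subset_compl_sUnion hopen (pairwiseDisjoint_range_cell N) hω).trans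
      ((compl_sUnion_range_cell_subset hN).trans hsub)⟩

theorem exists_isPolygonalPartition {β : ℝ} (hβ : 0 < β) :
    ∃ Ω, IsPolygonalPartition (affineMap β) Ω := by
  obtain ⟨N, hN⟩ := exists_nat_ge (max 2 β)
  refine ⟨_, isPolygonalPartition_range_cell hβ (N := N) ?_ ((le_max_right _ _).trans hN)⟩
  exact_mod_cast (le_max_left (2 : ℝ) β).trans hN

end Grid

end CutTorus

theorem mainTheorem4 (β : ℝ) (hβ : 1 < β) (hβ_transcendental : Transcendental ℚ β) :
    CutTorus.LambdaBV (CutTorus.affineMap β) (fun _ => 1) CutTorus.rightCurve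
        = ENNReal.ofReal (max 2 β) ∧
    CutTorus.LambdaBV (CutTorus.affineMap β) (CutTorus.invDetWeight (CutTorus.affineMap β))
        CutTorus.rightCurve = ENNReal.ofReal (min 2 β)⁻¹ ∧
    (∃ Ω, CutTorus.IsPolygonalPartition (CutTorus.affineMap β) Ω) ∧
    ∀ Ω, CutTorus.IsPolygonalPartition (CutTorus.affineMap β) Ω →
      CutTorus.HasMultiplicityEntropy (CutTorus.affineMap β) Ω 0 ∧
      CutTorus.HasLambdaBar (CutTorus.affineMap β) (fun _ => 1) Ω
        (ENNReal.ofReal (max 2 β)) ∧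
      CutTorus.HasLambdaBar (CutTorus.affineMap β)
        (CutTorus.invDetWeight (CutTorus.affineMap β)) Ω (ENNReal.ofReal (min 2 β)⁻¹) := by
  have hβ0 : 0 < β := by linarith
  -- Transcendence enters only to separate the two eigenvalues.
  have h2 : β ≠ 2 := by
    rintro rfl
    exact hβ_transcendental (isAlgebraic_algebraMap (2 : ℚ))
  have hm : 0 < min 2 β := lt_min two_pos hβ0
  set c : ℂ := ((|2 * β|⁻¹ : ℝ) : ℂ) with hc
  have hnorm : ‖c‖ = (2 * β)⁻¹ := by
    rw [hc, Complex.norm_real, Real.norm_of_nonneg (by positivity), abs_of_pos (by positivity)]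
  have hc0 : c ≠ 0 := by
    rw [← norm_pos_iff, hnorm]
    positivity
  -- This turns the common value `‖c‖ * max 2 β` into the stated one, by `2 * β = min 2 β * max 2
  -- β`.
  have hmin : ‖c‖ * max 2 β = (min 2 β)⁻¹ := by
    rw [hnorm, ← min_mul_max 2 β, mul_inv, inv_mul_cancel_right₀ (by positivity)]
  have hone : ‖(1 : ℂ)‖ * max 2 β = max 2 β := by rw [norm_one, one_mul]
  rw [CutTorus.invDetWeight_affineMap, ← hmin]
  refine ⟨?_, CutTorus.LambdaBV_affineMap_const hβ h2 hc0,
    CutTorus.exists_isPolygonalPartition hβ0, fun Ω hΩ => ?_⟩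
  · rw [CutTorus.LambdaBV_affineMap_const hβ h2 one_ne_zero, hone]
  · have hent := CutTorus.hasMultiplicityEntropy_zero hβ0.ne' hΩ
    refine ⟨hent, ?_, CutTorus.hasLambdaBar_affineMap_const hβ h2 hΩ hent hc0⟩
    have h := CutTorus.hasLambdaBar_affineMap_const hβ h2 hΩ hent one_ne_zero
    rwa [hone] at h
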